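/- Let $\mathbb{H}^2\times\mathbb{R}=\{(w,x_3): w\in\mathbb{C},\ |w|<1,\ x_3\in\mathbb{R}\}$ carry the metric $\frac{4|dw|^2}{(1-|w|^2)^2}+dx_3^2$. For $0\le R<1$ let $\Omega_R=\{z\in\mathbb{C}: R\le |z|<1\}$ and $\overline{\Omega_R}=\{R\le|z|\le 1\}$, and for $0<\alpha<1$ let $\mathcal{C}^{k,\alpha}(\overline{\Omega_R})$ be the usual Hölder space (derivatives up to order $k$ continuous up to the boundary and $\alpha$-Hölder). For $\eta\in\mathcal{C}^{2,\alpha}(\overline{\Omega_R})$ let $$X^\eta(z)=\Big(\frac{2z}{1+|z|^2},\ 2e^{\eta(z)}\,\frac{1+|z|^2}{1-|z|^2}\Big)\in\mathbb{H}^2\times\mathbb{R},\qquad z\in\Omega_R,$$ let $H(\eta)$ be the mean curvature of the immersion $X^\eta$ (half the trace of the second fundamental form with respect to the upward unit normal), and let $|g(\eta)|$ be the determinant of the induced metric in the coordinates used. Use either polar coordinates $(x_1,x_2)=(r,\theta)$, with $0<R<1$, or Cartesian coordinates $(x_1,x_2)$ on the plane, with $0\le R<1$ (polar coordinates being singular at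 the origin, which lies in $\Omega_0$). Subscripts denote partial derivatives in the chosen coordinates, one-sided on the boundary. In either coordinate system there are functions $A_{ij}(x,a,Da,\xi,D\xi)=A_{ji}(x,a,Da,\xi,D\xi)$, $i,j\in\{1,2\}$, and $B(x,a,Da,D^2a,\xi,D\xi)$, not depending on $R$, $\alpha$, $a$, $\xi$, which for every such $R$ are real-analytic in all their variables at all points with $x\in\overline{\Omega_R}$ (including $|z|=1$) and arbitrary values of the other variables, such that for all $\alpha\in(0,1)$ and $a,\xi\in\mathcal{C}^{2,\alpha}(\overline{\Omega_R})$: 1. on $\Omega_R$, $$\sqrt{|g(a)|}\,\big(H(a+\xi)-H(a)\big)=\sum_{i,j}A_{ij}(x,a,Da,\xi,D\xi)\,\xi_{ij}+B(x,a,Da,D^2a,\xi,D\xi);$$ 2. the functions $x\mapsto A_{ij}(x,a(x),Da(x),\xi(x),D\xi(x))$ and $x\mapsto B(x,a(x),Da(x),D^2a(x),\xi(x),D\xi(x))$ belong to $\mathcal{C}^{0,\alpha}(\overline{\Omega_R})$; 3. the matrix $A=(A_{ij})$ is coercive on $\overline{\Omega_R}$, including $|z|=1$: there is $\kappa>0$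 (depending on $a$ and $\xi$) with $\sum_{i,j}A_{ij}(x,a(x),Da(x),\xi(x),D\xi(x))\,v_iv_j\ge\kappa\,|v|^2$ for all $x\in\overline{\Omega_R}$ and $v\in\mathbb{R}^2$. -/

import Mathlib

noncomputable section

namespace H2R

/-! ### Surfaces in the Poincaré disk model of `ℍ² × ℝ` -/

/-- The product metric `4 |dw|² / (1 - |w|²)² + dx₃²` at the point `q = (w₁, w₂, x₃)`, as a
matrix. It is a Riemannian metric on `|w| < 1`. -/
def ambientMetric (q : Fin 3 → ℝ) : Matrix (Fin 3) (Fin 3) ℝ :=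
  Matrix.diagonal
    ![4 / (1 - (q 0 ^ 2 + q 1 ^ 2)) ^ 2, 4 / (1 - (q 0 ^ 2 + q 1 ^ 2)) ^ 2, 1]

/-- `∂_i G_{jk}` for the ambient metric `G`. -/
def ambientMetricDeriv (q : Fin 3 → ℝ) (i j k : Fin 3) : ℝ :=
  fderiv ℝ (fun x => ambientMetric x j k) q (Pi.single i 1)

/-- The Christoffel symbol `Γ^k_{ij}` of the Levi-Civita connection of the ambient metric. -/
def christoffel (q : Fin 3 → ℝ) (k i j : Fin 3) : ℝ :=
  (1 / 2) * ∑ m, (ambientMetric q)⁻¹ k m *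
    (ambientMetricDeriv q i j m + ambientMetricDeriv q j i m - ambientMetricDeriv q m i j)

/-- The `i`-th partial derivative of `u`, taken within the set `S` of parameters (one-sided at
boundary points of `S`). -/
def pd {E : Type*} [NormedAddCommGroup E] [NormedSpace ℝ E]
    (S : Set (Fin 2 → ℝ)) (i : Fin 2) (u : (Fin 2 → ℝ) → E) (p : Fin 2 → ℝ) : E :=
  fderivWithin ℝ u S p (Pi.single i 1)

/-- The metric induced by a parametrized surface `X : S → ℍ² × ℝ`. -/
def inducedMetric (S : Set (Fin 2 → ℝ)) (X : (Fin 2 → ℝ) → Fin 3 → ℝ) (p : Fin 2 → ℝ) :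
    Matrix (Fin 2) (Fin 2) ℝ :=
  Matrix.of fun i j => pd S i X p ⬝ᵥ (ambientMetric (X p)).mulVec (pd S j X p)

/-- A normal vector: the index of the covector `∂₁X × ∂₂X`, which annihilates `∂₁X` and `∂₂X`,
is raised with the ambient metric. It points upward if `(X¹, X²)` has positive Jacobian. -/
def normalField (S : Set (Fin 2 → ℝ)) (X : (Fin 2 → ℝ) → Fin 3 → ℝ) (p : Fin 2 → ℝ) :
    Fin 3 → ℝ :=
  (ambientMetric (X p))⁻¹.mulVec (crossProduct (pd S 0 X p) (pd S 1 X p))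

/-- The unit normal vector. -/
def unitNormal (S : Set (Fin 2 → ℝ)) (X : (Fin 2 → ℝ) → Fin 3 → ℝ) (p : Fin 2 → ℝ) :
    Fin 3 → ℝ :=
  (Real.sqrt (normalField S X p ⬝ᵥ (ambientMetric (X p)).mulVec (normalField S X p)))⁻¹ •
    normalField S X p

/-- The ambient covariant derivative `∇_{∂_i X} ∂_j X` along the surface. -/
def covDeriv (S : Set (Fin 2 → ℝ)) (X : (Fin 2 → ℝ) → Fin 3 → ℝ) (i j : Fin 2)
    (p : Fin 2 → ℝ) : Fin 3 → ℝ :=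
  fun k => pd S i (pd S j X) p k +
    ∑ l, ∑ m, christoffel (X p) k l m * pd S i X p l * pd S j X p m

/-- The second fundamental form `⟨∇_{∂_i X} ∂_j X, N⟩`. -/
def secondForm (S : Set (Fin 2 → ℝ)) (X : (Fin 2 → ℝ) → Fin 3 → ℝ) (p : Fin 2 → ℝ) :
    Matrix (Fin 2) (Fin 2) ℝ :=
  Matrix.of fun i j => covDeriv S X i j p ⬝ᵥ (ambientMetric (X p)).mulVec (unitNormal S X p)

/-- The mean curvature: half the trace of the second fundamental form with respect to the
induced metric. -/
def meanCurvature (S : Set (Fin 2 → ℝ)) (X : (Fin 2 → ℝ) → Fin 3 → ℝ) (p : Fin 2 → ℝ) : ℝ :=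
  (1 / 2) * ((inducedMetric S X p)⁻¹ * secondForm S X p).trace

/-! ### Charts on the admissible domains `Ω_R = {R ≤ |z| < 1}` -/

/-- The two coordinate systems: polar coordinates `(r, θ)` and Cartesian coordinates `(x, y)`. -/
inductive Chart
  | polar
  | cartesian

/-- The point of the plane with given coordinates. -/
def Chart.toPlane : Chart → (Fin 2 → ℝ) → (Fin 2 → ℝ)
  | .polar, p => ![p 0 * Real.cos (p 1), p 0 * Real.sin (p 1)]
  | .cartesian, p => p

/-- The inner radii `R` for which the chart is regular on the closure of `Ω_R`: polar coordinates
are singular at the origin, which belongs to `Ω_R` for `R = 0` only. -/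
def Chart.radii : Chart → Set ℝ
  | .polar => Set.Ioo 0 1
  | .cartesian => Set.Ico 0 1

/-- The closure `{R ≤ |z| ≤ 1}` of `Ω_R` in the chart; in polar coordinates `θ` runs through `ℝ`. -/
def Chart.closedDomain : Chart → ℝ → Set (Fin 2 → ℝ)
  | .polar, R => {p | R ≤ p 0 ∧ p 0 ≤ 1}
  | .cartesian, R => {p | R ^ 2 ≤ p 0 ^ 2 + p 1 ^ 2 ∧ p 0 ^ 2 + p 1 ^ 2 ≤ 1}

/-- The domain `Ω_R = {R ≤ |z| < 1}` in the chart. -/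
def Chart.domain : Chart → ℝ → Set (Fin 2 → ℝ)
  | .polar, R => {p | R ≤ p 0 ∧ p 0 < 1}
  | .cartesian, R => {p | R ^ 2 ≤ p 0 ^ 2 + p 1 ^ 2 ∧ p 0 ^ 2 + p 1 ^ 2 < 1}

/-- The function `u` of the coordinates is a function on the closure of `Ω_R`: in polar
coordinates it is `2π`-periodic in `θ`. -/
def Chart.IsFunction : Chart → ℝ → ((Fin 2 → ℝ) → ℝ) → Prop
  | .polar, R, u => ∀ p ∈ Chart.polar.closedDomain R, u (p + ![0, 2 * Real.pi]) = u p
  | .cartesian, _, _ => True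

/-- `u` belongs to `𝒞^{k,α}` of the closure of `Ω_R`: it is `k` times continuously differentiable
up to the boundary and its derivatives up to order `k` are `α`-Hölder continuous there. -/
def Chart.MemHolder (c : Chart) (R : ℝ) (k : ℕ) (α : NNReal) (u : (Fin 2 → ℝ) → ℝ) : Prop :=
  c.IsFunction R u ∧ ContDiffOn ℝ k u (c.closedDomain R) ∧
    ∀ m ≤ k, ∃ C : NNReal,
      HolderOnWith C α (iteratedFDerivWithin ℝ m u (c.closedDomain R)) (c.closedDomain R)

/-! ### Graph coordinates at infinity -/

/-- `|z|²` at the point with coordinates `p`. -/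
def Chart.radiusSq (c : Chart) (p : Fin 2 → ℝ) : ℝ :=
  c.toPlane p 0 ^ 2 + c.toPlane p 1 ^ 2

/-- The immersion `X^η = (2z / (1 + |z|²), 2 e^η (1 + |z|²) / (1 - |z|²))`. -/
def Chart.surface (c : Chart) (η : (Fin 2 → ℝ) → ℝ) (p : Fin 2 → ℝ) : Fin 3 → ℝ :=
  ![2 / (1 + c.radiusSq p) * c.toPlane p 0,
    2 / (1 + c.radiusSq p) * c.toPlane p 1,
    2 * Real.exp (η p) * ((1 + c.radiusSq p) / (1 - c.radiusSq p))]

/-- The mean curvature `H(η)` of `X^η` on `Ω_R`, for the upward pointing normal. -/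
def Chart.H (c : Chart) (R : ℝ) (η : (Fin 2 → ℝ) → ℝ) (p : Fin 2 → ℝ) : ℝ :=
  meanCurvature (c.closedDomain R) (c.surface η) p

/-- The determinant `|g(η)|` of the metric induced by `X^η` in the coordinates of the chart. -/
def Chart.detMetric (c : Chart) (R : ℝ) (η : (Fin 2 → ℝ) → ℝ) (p : Fin 2 → ℝ) : ℝ :=
  (inducedMetric (c.closedDomain R) (c.surface η) p).det

/-! ### Jets -/

/-- Values `(u, Du)`. -/
abbrev Jet1 := ℝ × (Fin 2 → ℝ)

/-- Values `(u, Du, D²u)`. -/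
abbrev Jet2 := ℝ × (Fin 2 → ℝ) × (Fin 2 → Fin 2 → ℝ)

/-- The 1-jet of `u`, with derivatives taken within `S`. -/
def jet1 (S : Set (Fin 2 → ℝ)) (u : (Fin 2 → ℝ) → ℝ) (p : Fin 2 → ℝ) : Jet1 :=
  (u p, fun i => pd S i u p)

/-- The 2-jet of `u`, with derivatives taken within `S`. -/
def jet2 (S : Set (Fin 2 → ℝ)) (u : (Fin 2 → ℝ) → ℝ) (p : Fin 2 → ℝ) : Jet2 :=
  (u p, fun i => pd S i u p, fun i j => pd S i (pd S j u) p)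

end H2R

end

/-!
Put `s = 1 - |z|²` and `u = 1 + |z|²`. The surface `X^η` is a graph with height `h = 2 e^η u / s`
over the hyperbolic disk, reparametrized by `z ↦ 2z / u`. For a graph, `2H W` is the trace of the
covariant Hessian of `h` with respect to the induced metric, where `W = √(1 + |∇h|²)`
(`meanCurvature_graph`), and `√|g| = 16 u V / s⁴` with `V = s W` (times `r` in polar coordinates).
The function `V` is the square root of a polynomial in `s`, `e^η`, `z · Dη` and `|Dη|²` which is
positive also at `s = 0` (`slopeSq_pos`), so `V` is analytic up to the boundary.

The mean curvature tends to `1/2` at `s = 0`, and the point is that `√|g| (2H - 1)` is an analytic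
function of the 2-jet of `η` up to `s = 0`, although `√|g|` blows up like `s⁻⁴`. The coefficients of
its second derivatives are `2 e^η / V²` times a matrix, the symbol, proportional to the inverse of
the induced metric; its determinant is `u² V²` (`Chart.symbol_det`), so that the operator stays
elliptic at the boundary. The remaining terms have the form `N / (s⁴ V²) - 16 u V / s⁴` with a
polynomial `N`. They are regular because `N - 16 u V³` is a multiple of `s⁴`: there is a polynomial
`p` with `V² - p² = s² τ`, hence `V - p = s² τ / (V + p)`, and the identity
`2 V³ = 3 p V² - p³ + (V - p)² (2 V + p)` replaces `2 V³` by a polynomial up to a multiple of `s⁴`;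
the difference of the two polynomials is divisible by `s⁴` (`lowerOrder_eq`). The computation is
carried out in both charts (`cartesian_operator`, `polar_operator`), and the lower order terms come
out as the same rotation invariant function.

Write `Q(η)` for `√|g(η)| (2H(η) - 1)` and `b = a + ξ`. Then
`√|g(a)| (H(b) - H(a)) = ½ ((V_a / V_b) Q(b) - Q(a))` (`Chart.sqrt_detMetric_mul_sub`). As `Q` is
affine in the second derivatives, this is quasilinear in `ξ`, with principal coefficients
`½ (V_a / V_b)` times those of `Q(b)`. The coefficients are analytic on the closed domain, and
compositions of analytic functions with Hölder continuous ones are Hölder continuous on compact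
sets (`exists_holderOnWith_comp`). In polar coordinates the closed domain is a strip, where
periodicity in the angle reduces everything to a compact rectangle. Coercivity follows from the
positivity of the determinant and the trace of the coefficient matrix on a compact set
(`Chart.exists_coercive`).
-/

noncomputable section

namespace H2R

open Filter Topology

/-! ### The mean curvature in terms of the ambient coordinates -/

theorem fderiv_conformalFactor (q : Fin 3 → ℝ) (hq : 1 - (q 0 ^ 2 + q 1 ^ 2) ≠ 0) (i : Fin 3) :
    fderiv ℝ (fun x : Fin 3 → ℝ => 4 / (1 - (x 0 ^ 2 + x 1 ^ 2)) ^ 2) q (Pi.single i 1) =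
      ![16 * q 0 / (1 - (q 0 ^ 2 + q 1 ^ 2)) ^ 3,
        16 * q 1 / (1 - (q 0 ^ 2 + q 1 ^ 2)) ^ 3, 0] i := by
  have h0 := hasFDerivAt_apply (𝕜 := ℝ) (F' := fun _ : Fin 3 => ℝ) (0 : Fin 3) q
  have h1 := hasFDerivAt_apply (𝕜 := ℝ) (F' := fun _ : Fin 3 => ℝ) (1 : Fin 3) q
  have h := (((h0.pow 2).add (h1.pow 2)).const_sub 1).pow 2
  have h' := (hasDerivAt_inv (pow_ne_zero 2 hq)).comp_hasFDerivAt q h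
  have h'' := (h'.const_mul 4).fderiv
  have e : (fun x : Fin 3 → ℝ => 4 / (1 - (x 0 ^ 2 + x 1 ^ 2)) ^ 2) =
      fun x => 4 * ((fun y : ℝ => y⁻¹) ∘ fun x : Fin 3 → ℝ => (1 - (x 0 ^ 2 + x 1 ^ 2)) ^ 2) x := by
    ext x; simp [div_eq_mul_inv]
  rw [e]
  erw [h'']
  fin_cases i <;> simp <;> field_simp <;> ring

theorem ambientMetric_inv (q : Fin 3 → ℝ) (hq : 1 - (q 0 ^ 2 + q 1 ^ 2) ≠ 0) :
    (ambientMetric q)⁻¹ = Matrix.diagonal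
      ![(1 - (q 0 ^ 2 + q 1 ^ 2)) ^ 2 / 4, (1 - (q 0 ^ 2 + q 1 ^ 2)) ^ 2 / 4, 1] := by
  refine Matrix.inv_eq_right_inv ?_
  rw [ambientMetric, Matrix.diagonal_mul_diagonal, ← Matrix.diagonal_one]
  congr 1
  ext i
  fin_cases i <;> simp <;> field_simp <;> exact hq

theorem ambientMetricDeriv_eq (q : Fin 3 → ℝ) (hq : 1 - (q 0 ^ 2 + q 1 ^ 2) ≠ 0) (i j k : Fin 3) :
    ambientMetricDeriv q i j k = if j = k ∧ j ≠ 2 then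
      ![16 * q 0 / (1 - (q 0 ^ 2 + q 1 ^ 2)) ^ 3, 16 * q 1 / (1 - (q 0 ^ 2 + q 1 ^ 2)) ^ 3, 0] i
      else 0 := by
  have h := fderiv_conformalFactor q hq i
  unfold ambientMetricDeriv ambientMetric
  by_cases hjk : j = k
  · subst hjk
    simp only [Matrix.diagonal_apply_eq, true_and]
    fin_cases j
    · simpa using h
    · simpa using h
    · simp
  · simp [hjk]

/-- The quadratic part of the ambient covariant derivative. The disk metric is conformal to the
Euclidean one, so that this is the change of a Levi-Civita connection under a conformal factor. -/
theorem sum_christoffel (q : Fin 3 → ℝ) (hq : 1 - (q 0 ^ 2 + q 1 ^ 2) ≠ 0) (v w : Fin 3 → ℝ)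
    (k : Fin 3) :
    ∑ l, ∑ m, christoffel q k l m * v l * w m =
      ![2 / (1 - (q 0 ^ 2 + q 1 ^ 2)) * ((q 0 * v 0 + q 1 * v 1) * w 0 +
          (q 0 * w 0 + q 1 * w 1) * v 0 - (v 0 * w 0 + v 1 * w 1) * q 0),
        2 / (1 - (q 0 ^ 2 + q 1 ^ 2)) * ((q 0 * v 0 + q 1 * v 1) * w 1 +
          (q 0 * w 0 + q 1 * w 1) * v 1 - (v 0 * w 0 + v 1 * w 1) * q 1), 0] k := by
  simp only [christoffel, ambientMetric_inv q hq, ambientMetricDeriv_eq q hq]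
  fin_cases k <;> simp [Fin.sum_univ_three, Matrix.diagonal_apply] <;> field_simp <;> ring

/-- The mean curvature in terms of the cross product `c = ∂₀X × ∂₁X`. -/
theorem meanCurvature_eq (S : Set (Fin 2 → ℝ)) (X : (Fin 2 → ℝ) → Fin 3 → ℝ) (p : Fin 2 → ℝ)
    (hq : 1 - (X p 0 ^ 2 + X p 1 ^ 2) ≠ 0) (c : Fin 3 → ℝ)
    (hc : crossProduct (pd S 0 X p) (pd S 1 X p) = c) :
    meanCurvature S X p = 1 / 2 *
      ((inducedMetric S X p 1 1 * (covDeriv S X 0 0 p ⬝ᵥ c) -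
        inducedMetric S X p 0 1 * (covDeriv S X 0 1 p ⬝ᵥ c + covDeriv S X 1 0 p ⬝ᵥ c) +
        inducedMetric S X p 0 0 * (covDeriv S X 1 1 p ⬝ᵥ c)) /
      ((inducedMetric S X p).det *
        √((1 - (X p 0 ^ 2 + X p 1 ^ 2)) ^ 2 / 4 * (c 0 ^ 2 + c 1 ^ 2) + c 2 ^ 2))) := by
  have hsymm : inducedMetric S X p 1 0 = inducedMetric S X p 0 1 := by
    simp [inducedMetric, ambientMetric, Matrix.mulVec_diagonal, dotProduct, Fin.sum_univ_three]
    ring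
  have hnorm : normalField S X p ⬝ᵥ (ambientMetric (X p)).mulVec (normalField S X p) =
      (1 - (X p 0 ^ 2 + X p 1 ^ 2)) ^ 2 / 4 * (c 0 ^ 2 + c 1 ^ 2) + c 2 ^ 2 := by
    rw [normalField, hc, ambientMetric_inv _ hq]
    simp [ambientMetric, Matrix.mulVec_diagonal, dotProduct, Fin.sum_univ_three]
    field_simp
  have hL : ∀ i j, secondForm S X p i j = (covDeriv S X i j p ⬝ᵥ c) /
      √((1 - (X p 0 ^ 2 + X p 1 ^ 2)) ^ 2 / 4 * (c 0 ^ 2 + c 1 ^ 2) + c 2 ^ 2) := by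
    intro i j
    rw [secondForm, Matrix.of_apply, unitNormal, hnorm, normalField, hc, ambientMetric_inv _ hq]
    simp [ambientMetric, Matrix.mulVec_diagonal, dotProduct, Fin.sum_univ_three]
    field_simp
  rw [meanCurvature, Matrix.inv_def, Matrix.adjugate_fin_two, Ring.inverse_eq_inv']
  simp only [Matrix.trace_fin_two, Matrix.smul_mul, Matrix.smul_apply, Matrix.mul_apply,
    Fin.sum_univ_two, hL, smul_eq_mul]
  simp only [Matrix.of_apply, Matrix.cons_val', Matrix.cons_val_zero, Matrix.cons_val_one,
    Matrix.cons_val_fin_one, hsymm]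
  rw [div_mul_eq_div_div_swap]
  ring

/-! ### Partial derivatives within a set -/

section

variable {S : Set (Fin 2 → ℝ)} {p : Fin 2 → ℝ}

theorem pd_congr {u v : (Fin 2 → ℝ) → ℝ} {i : Fin 2} (h : ∀ᶠ q in 𝓝[S] p, u q = v q)
    (hp : p ∈ S) : pd S i u p = pd S i v p := by
  unfold pd
  rw [Filter.EventuallyEq.fderivWithin_eq h (h.self_of_nhdsWithin hp)]

theorem pd_mul {u v : (Fin 2 → ℝ) → ℝ} {i : Fin 2} (hS : UniqueDiffWithinAt ℝ S p)
    (hu : DifferentiableWithinAt ℝ u S p) (hv : DifferentiableWithinAt ℝ v S p) :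
    pd S i (fun q => u q * v q) p = u p * pd S i v p + pd S i u p * v p := by
  unfold pd
  rw [fderivWithin_fun_mul hS hu hv]
  simp [mul_comm]

theorem pd_add {u v : (Fin 2 → ℝ) → ℝ} {i : Fin 2} (hS : UniqueDiffWithinAt ℝ S p)
    (hu : DifferentiableWithinAt ℝ u S p) (hv : DifferentiableWithinAt ℝ v S p) :
    pd S i (fun q => u q + v q) p = pd S i u p + pd S i v p := by
  unfold pd
  rw [fderivWithin_fun_add hS hu hv]
  simp

theorem pd_comp {u : (Fin 2 → ℝ) → ℝ} {φ : ℝ → ℝ} {φ' : ℝ} {i : Fin 2}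
    (hS : UniqueDiffWithinAt ℝ S p) (hφ : HasDerivAt φ φ' (u p))
    (hu : DifferentiableWithinAt ℝ u S p) :
    pd S i (fun q => φ (u q)) p = φ' * pd S i u p := by
  unfold pd
  have := (hφ.comp_hasFDerivWithinAt p hu.hasFDerivWithinAt).fderivWithin hS
  simp only [Function.comp_def] at this
  rw [this]
  simp

theorem pd_const {i : Fin 2} (a : ℝ) : pd S i (fun _ => a) p = 0 := by
  simp [pd]

theorem pd_coord {i k : Fin 2} (hS : UniqueDiffWithinAt ℝ S p) :
    pd S i (fun q => q k) p = if i = k then 1 else 0 := by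
  unfold pd
  have := (hasFDerivWithinAt_apply (𝕜 := ℝ) (F' := fun _ : Fin 2 => ℝ) k p S).fderivWithin hS
  rw [this]
  simp [Pi.single_apply, eq_comm]

theorem pd_comp_coord {φ : ℝ → ℝ} {φ' : ℝ} {i k : Fin 2}
    (hS : UniqueDiffWithinAt ℝ S p) (hφ : HasDerivAt φ φ' (p k)) :
    pd S i (fun q => φ (q k)) p = if i = k then φ' else 0 := by
  rw [pd_comp (u := fun q => q k) hS hφ (by fun_prop), pd_coord hS]
  simp

theorem pd_comp_sq_norm {φ : ℝ → ℝ} {φ' : ℝ} {i : Fin 2} (hS : UniqueDiffWithinAt ℝ S p)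
    (hφ : HasDerivAt φ φ' (p 0 ^ 2 + p 1 ^ 2)) :
    pd S i (fun q => φ (q 0 ^ 2 + q 1 ^ 2)) p = φ' * (2 * p i) := by
  rw [pd_comp (u := fun q => q 0 ^ 2 + q 1 ^ 2) hS hφ (by fun_prop),
    pd_add (u := fun q => q 0 ^ 2) (v := fun q => q 1 ^ 2) hS (by fun_prop) (by fun_prop),
    pd_comp_coord (φ := fun t => t ^ 2) hS (hasDerivAt_pow 2 _),
    pd_comp_coord (φ := fun t => t ^ 2) hS (hasDerivAt_pow 2 _)]
  fin_cases i <;> simp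

theorem pd_apply {X : (Fin 2 → ℝ) → Fin 3 → ℝ} {i : Fin 2} (hS : UniqueDiffWithinAt ℝ S p)
    (hX : ∀ k, DifferentiableWithinAt ℝ (fun q => X q k) S p) (k : Fin 3) :
    pd S i X p k = pd S i (fun q => X q k) p := by
  unfold pd
  rw [fderivWithin_pi hX hS]
  simp

theorem differentiableWithinAt_pd {u : (Fin 2 → ℝ) → ℝ} (hS : UniqueDiffOn ℝ S)
    (hu : ContDiffOn ℝ 2 u S) (hp : p ∈ S) (i : Fin 2) :
    DifferentiableWithinAt ℝ (pd S i u) S p := by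
  have h := (hu.fderivWithin hS (m := 1) (by norm_num)).differentiableOn (by norm_num) p hp
  unfold pd
  fun_prop

/-- First derivatives of the height `2 e^η f`. -/
theorem pd_height {η f : (Fin 2 → ℝ) → ℝ} {i : Fin 2} (hS : UniqueDiffWithinAt ℝ S p)
    (hη : DifferentiableWithinAt ℝ η S p) (hf : DifferentiableWithinAt ℝ f S p) :
    pd S i (fun q => 2 * Real.exp (η q) * f q) p =
      2 * Real.exp (η p) * (f p * pd S i η p + pd S i f p) := by
  rw [pd_mul (u := fun q => 2 * Real.exp (η q)) hS (by fun_prop) hf,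
    pd_comp (φ := fun t => 2 * Real.exp t) hS ((Real.hasDerivAt_exp _).const_mul 2) hη]
  ring

/-- Second derivatives of the height `2 e^η f`. -/
theorem pd_pd_height {η f fj : (Fin 2 → ℝ) → ℝ} {i j : Fin 2} (hS : UniqueDiffOn ℝ S)
    (hη : ContDiffOn ℝ 2 η S) (hp : p ∈ S) (hf : ∀ᶠ q in 𝓝[S] p, DifferentiableWithinAt ℝ f S q)
    (hfj : ∀ᶠ q in 𝓝[S] p, pd S j f q = fj q) (hfj' : DifferentiableWithinAt ℝ fj S p) :
    pd S i (pd S j (fun q => 2 * Real.exp (η q) * f q)) p =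
      2 * Real.exp (η p) * (f p * pd S i η p * pd S j η p + f p * pd S i (pd S j η) p +
        pd S i f p * pd S j η p + pd S i η p * fj p + pd S i fj p) := by
  have hη' := hη.differentiableOn (by norm_num)
  have hd := differentiableWithinAt_pd hS hη hp j
  have hfp := hf.self_of_nhdsWithin hp
  have h : ∀ᶠ q in 𝓝[S] p, pd S j (fun q => 2 * Real.exp (η q) * f q) q =
      2 * Real.exp (η q) * (f q * pd S j η q + fj q) := by
    filter_upwards [hf, hfj, self_mem_nhdsWithin] with q h1 h2 h3
    rw [pd_height (hS q h3) (hη' q h3) h1, h2]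
  rw [pd_congr h hp, pd_height (f := fun q => f q * pd S j η q + fj q) (hS p hp) (hη' p hp)
    ((hfp.mul hd).add hfj'), pd_add (u := fun q => f q * pd S j η q) (hS p hp) (hfp.mul hd) hfj',
    pd_mul (hS p hp) hfp hd]
  ring

/-! ### The mean curvature of a graph -/

/-- The mean curvature of a graph `x₃ = h` over a parametrized region of the disk with tangent
vectors `a i` and base Christoffel symbols `Γ k i j`: the second fundamental form is the base
Hessian of `h`, divided by `W = √(1 + |∇h|²)`. The number `D` is `1 - |w|²` at the point `w` of the
disk, so that `4 / D²` is the conformal factor of the base, and `J` is the Jacobian of the base map;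
`k i j` is the second derivative `∂_i ∂_j h`. -/
theorem meanCurvature_graph {X : (Fin 2 → ℝ) → Fin 3 → ℝ} {D J W : ℝ}
    {a : Fin 2 → Fin 2 → ℝ} {h : Fin 2 → ℝ} {k : Fin 2 → Fin 2 → ℝ}
    {Γ : Fin 2 → Fin 2 → Fin 2 → ℝ}
    (hD : 1 - (X p 0 ^ 2 + X p 1 ^ 2) = D) (hD0 : D ≠ 0) (hJ0 : 0 < J) (hW0 : 0 < W)
    (hX : ∀ i, pd S i X p = ![a i 0, a i 1, h i])
    (hcov : ∀ i j, covDeriv S X i j p = ![Γ 0 i j * a 0 0 + Γ 1 i j * a 1 0,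
      Γ 0 i j * a 0 1 + Γ 1 i j * a 1 1, k i j])
    (hJ : a 0 0 * a 1 1 - a 0 1 * a 1 0 = J)
    (hW : D ^ 2 / 4 * ((a 0 1 * h 1 - h 0 * a 1 1) ^ 2 + (h 0 * a 1 0 - a 0 0 * h 1) ^ 2) + J ^ 2 =
      (J * W) ^ 2) :
    (inducedMetric S X p).det = (4 / D ^ 2 * J * W) ^ 2 ∧
    meanCurvature S X p = 1 / 2 *
      (((4 / D ^ 2 * (a 1 0 ^ 2 + a 1 1 ^ 2) + h 1 ^ 2) *
          (k 0 0 - (Γ 0 0 0 * h 0 + Γ 1 0 0 * h 1)) -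
        (4 / D ^ 2 * (a 0 0 * a 1 0 + a 0 1 * a 1 1) + h 0 * h 1) *
          (k 0 1 + k 1 0 - ((Γ 0 0 1 + Γ 0 1 0) * h 0 + (Γ 1 0 1 + Γ 1 1 0) * h 1)) +
        (4 / D ^ 2 * (a 0 0 ^ 2 + a 0 1 ^ 2) + h 0 ^ 2) *
          (k 1 1 - (Γ 0 1 1 * h 0 + Γ 1 1 1 * h 1))) /
      ((4 / D ^ 2 * J * W) ^ 2 * W)) := by
  have hg : ∀ i j, inducedMetric S X p i j =
      4 / D ^ 2 * (a i 0 * a j 0 + a i 1 * a j 1) + h i * h j := by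
    intro i j
    simp only [inducedMetric, Matrix.of_apply, hX, ambientMetric, hD, Matrix.mulVec_diagonal,
      dotProduct, Fin.sum_univ_three]
    simp
    ring
  have hdet : (inducedMetric S X p).det = (4 / D ^ 2 * J * W) ^ 2 := by
    have e : (4 / D ^ 2 * J * W) ^ 2 = 16 / D ^ 4 * (J * W) ^ 2 := by field_simp; ring
    rw [Matrix.det_fin_two, hg, hg, hg, hg, e, ← hW, ← hJ]
    field_simp
    ring
  refine ⟨hdet, ?_⟩
  rw [meanCurvature_eq S X p (hD ▸ hD0) _ rfl, hdet, hD]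
  have hc : crossProduct (pd S 0 X p) (pd S 1 X p) =
      ![a 0 1 * h 1 - h 0 * a 1 1, h 0 * a 1 0 - a 0 0 * h 1, J] := by
    rw [hX, hX, cross_apply, ← hJ]
    simp
  have hsq : √(D ^ 2 / 4 * ((a 0 1 * h 1 - h 0 * a 1 1) ^ 2 + (h 0 * a 1 0 - a 0 0 * h 1) ^ 2) +
      J ^ 2) = J * W := by
    rw [hW, Real.sqrt_sq (by positivity)]
  have hℓ : ∀ i j, covDeriv S X i j p ⬝ᵥ crossProduct (pd S 0 X p) (pd S 1 X p) =
      J * (k i j - (Γ 0 i j * h 0 + Γ 1 i j * h 1)) := by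
    intro i j
    rw [hc, hcov, ← hJ]
    simp only [dotProduct, Fin.sum_univ_three]
    simp
    ring
  simp only [hℓ, hg]
  simp only [hc]
  simp only [Matrix.cons_val_zero, Matrix.cons_val_one, Matrix.cons_val, hsq]
  field_simp
  ring

end

/-! ### The slope and the cancellation at `|z| = 1` -/

/-- `(1 - |z|²)² W²` in terms of `s = 1 - |z|²`, `e = e^η`, `m = z · Dη` and `n = |Dη|²`, where
`W = √(1 + |∇h|²)` is the area element of the graph of the height `h` over the disk. -/
def slopeSq (s e m n : ℝ) : ℝ :=
  s ^ 2 + e ^ 2 * (4 * (1 - s) + 2 * s * (2 - s) * m + s ^ 2 * (s ^ 2 * n + 4 * m ^ 2) / 4)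

/-- `(1 - |z|²) W`. Unlike the area element `W` itself, it is regular and positive at `|z| = 1`. -/
def slope (s e m n : ℝ) : ℝ := √(slopeSq s e m n)

/-- A polynomial with `slope - slopeApprox = O(s²)` as `s → 0`. -/
def slopeApprox (s e m : ℝ) : ℝ := e * ((2 + s) / 4) * (4 * (1 - s) + s * (2 - s) * m)

/-- The quotient `(slopeSq - slopeApprox²) / s²`. -/
def slopeDefect (s e m n : ℝ) : ℝ :=
  1 + e ^ 2 * ((3 + s) / 4 * (4 * (1 - s) + 2 * s * (2 - s) * m) +
    m ^ 2 * (s ^ 2 / 2 - s ^ 4 / 16) + s ^ 2 * n / 4)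

/-- The contraction of the symbol of the mean curvature operator with the part of the covariant
Hessian of the height that is free of second derivatives of `η`, up to powers of `s` and the factor
`1 + |z|²`. -/
def hessNumer (s e m n : ℝ) : ℝ :=
  2 * e * (s ^ 4 * (s ^ 2 * n + 4 * m ^ 2) - 4 * s ^ 3 * (2 - s) ^ 2 * m -
      32 * (2 - s + s * m) * (1 - s) * (2 - s) +
      (s ^ 2 + (2 - s) ^ 2) * (4 * s ^ 2 - 32 * s + 32 + 2 * (s ^ 2 - 4 * s + 8) * s * m)) +
  e ^ 3 / 2 * (16 * s ^ 4 * ((1 - s) * n - m ^ 2) * (3 - s) -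
      32 * (2 - s + s * m) * (2 - s) * s ^ 2 * ((1 - s) * n - m ^ 2) +
      (4 * s ^ 2 - 32 * s + 32 + 2 * (s ^ 2 - 4 * s + 8) * s * m) *
        ((2 - s) ^ 2 * s ^ 2 * n + 8 * (2 - s) * s * m + 16 * (1 - s)))

/-- The terms without second derivatives of `η` in `√|g| (2H - 1)`, written without division by
`s`. -/
def lowerOrder (s e m n : ℝ) : ℝ :=
  (e * (40 - 24 * s + 8 * m + 12 * s * m - 6 * s ^ 2 * m + 8 * m ^ 2 + 2 * s ^ 2 * n) +
    e ^ 3 * (56 - 72 * s + 8 * s ^ 2 + 8 * s ^ 3 +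
      n * (8 - 16 * s + 16 * s ^ 2 - 6 * s ^ 3) +
      m * (-8 + 84 * s - 66 * s ^ 2 + 6 * s ^ 4) +
      m * n * (-2 * s ^ 2 + 4 * s ^ 3 - 3 / 2 * s ^ 4) +
      m ^ 2 * (-8 + 30 * s ^ 2 - 18 * s ^ 3 - 3 / 2 * s ^ 4 + 3 / 2 * s ^ 5) +
      m ^ 3 * (3 * s ^ 3 - 3 / 2 * s ^ 4 - 1 / 4 * s ^ 5 + 1 / 8 * s ^ 6)) -
    8 * (2 - s) * slopeDefect s e m n ^ 2 * (2 * slope s e m n + slopeApprox s e m) /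
      (slope s e m n + slopeApprox s e m) ^ 2) / slopeSq s e m n

theorem slopeSq_sub_sq (s e m n : ℝ) :
    slopeSq s e m n - slopeApprox s e m ^ 2 = s ^ 2 * slopeDefect s e m n := by
  unfold slopeSq slopeApprox slopeDefect
  ring

/-- Comparison of `slope` with its radial part. The last term is nonnegative by the Cauchy-Schwarz
inequality `m² ≤ |z|² n`. -/
theorem four_mul_slopeSq (s e m n : ℝ) :
    4 * (1 - s) * (slopeSq s e m n - s ^ 2) =
      e ^ 2 * ((4 * (1 - s) + s * (2 - s) * m) ^ 2 + s ^ 4 * ((1 - s) * n - m ^ 2)) := by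
  unfold slopeSq
  ring

theorem slopeSq_pos {s e m n : ℝ} (hs0 : 0 ≤ s) (hs1 : s ≤ 1) (he : 0 < e) (hn : 0 ≤ n)
    (hmn : m ^ 2 ≤ (1 - s) * n) : 0 < slopeSq s e m n := by
  rcases hs0.eq_or_lt with rfl | hs
  · unfold slopeSq
    nlinarith [pow_pos he 2]
  rcases hs1.eq_or_lt with rfl | hs1
  · have hm : m = 0 := by nlinarith [sq_nonneg m]
    subst hm
    unfold slopeSq
    nlinarith [mul_nonneg (sq_nonneg e) hn]
  have h := four_mul_slopeSq s e m n
  have h2 : 0 ≤ e ^ 2 * ((4 * (1 - s) + s * (2 - s) * m) ^ 2 + s ^ 4 * ((1 - s) * n - m ^ 2)) :=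
    mul_nonneg (sq_nonneg e) (add_nonneg (sq_nonneg _) (mul_nonneg (by positivity) (by linarith)))
  rw [← h] at h2
  have h3 := nonneg_of_mul_nonneg_right h2 (by linarith)
  nlinarith [pow_pos hs 2]

theorem slope_pos {s e m n : ℝ} (hs0 : 0 ≤ s) (hs1 : s ≤ 1) (he : 0 < e) (hn : 0 ≤ n)
    (hmn : m ^ 2 ≤ (1 - s) * n) : 0 < slope s e m n :=
  Real.sqrt_pos.2 (slopeSq_pos hs0 hs1 he hn hmn)

theorem slope_add_approx_pos {s e m n : ℝ} (hs0 : 0 ≤ s) (hs1 : s ≤ 1) (he : 0 < e) (hn : 0 ≤ n)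
    (hmn : m ^ 2 ≤ (1 - s) * n) : 0 < slope s e m n + slopeApprox s e m := by
  have hV := slope_pos hs0 hs1 he hn hmn
  have hV2 : slope s e m n ^ 2 = slopeSq s e m n :=
    Real.sq_sqrt (slopeSq_pos hs0 hs1 he hn hmn).le
  rcases hs0.eq_or_lt with rfl | hs
  · refine add_pos hV ?_
    unfold slopeApprox
    linarith
  rcases hs1.eq_or_lt with rfl | hs1
  · have hm : m = 0 := by nlinarith [sq_nonneg m]
    subst hm
    simpa [slopeApprox] using hV
  -- it suffices that `slopeApprox² < slopeSq`
  have hk : 4 * (1 - s) * slopeApprox s e m ^ 2 ≤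
      e ^ 2 * (4 * (1 - s) + s * (2 - s) * m) ^ 2 := by
    have e1 : 4 * (1 - s) * slopeApprox s e m ^ 2 = e ^ 2 * (4 * (1 - s) + s * (2 - s) * m) ^ 2 -
        (s ^ 2 * (3 + s) / 4) * (e ^ 2 * (4 * (1 - s) + s * (2 - s) * m) ^ 2) := by
      unfold slopeApprox
      ring
    have : 0 ≤ (s ^ 2 * (3 + s) / 4) * (e ^ 2 * (4 * (1 - s) + s * (2 - s) * m) ^ 2) := by
      positivity
    linarith
  have h := four_mul_slopeSq s e m n
  have h4 : 0 ≤ e ^ 2 * (s ^ 4 * ((1 - s) * n - m ^ 2)) :=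
    mul_nonneg (sq_nonneg e) (mul_nonneg (by positivity) (by linarith))
  have h5 : slopeApprox s e m ^ 2 ≤ slopeSq s e m n - s ^ 2 := by
    refine le_of_mul_le_mul_left ?_ (show 0 < 4 * (1 - s) by linarith)
    linarith
  have h6 : slopeApprox s e m ^ 2 < slope s e m n ^ 2 := by
    rw [hV2]
    nlinarith [pow_pos hs 2]
  have := (abs_lt_of_sq_lt_sq' h6 hV.le).1
  linarith

/-- The cancellation at `|z| = 1`. With `V = slope` and `p = slopeApprox`, one has
`2 V³ = 3 p V² - p³ + (V - p)² (2 V + p)`, where `V - p = s² slopeDefect / (V + p)`; hence `16 u V³`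
is a polynomial up to a multiple of `s⁴`, and this polynomial agrees with `hessNumer` to order
`s⁴`. -/
theorem lowerOrder_eq {s e m n : ℝ} (hs : s ≠ 0) (hs0 : 0 ≤ s) (hs1 : s ≤ 1) (he : 0 < e)
    (hn : 0 ≤ n) (hmn : m ^ 2 ≤ (1 - s) * n) :
    lowerOrder s e m n = hessNumer s e m n / (s ^ 4 * slopeSq s e m n) -
      16 * (2 - s) * slope s e m n / s ^ 4 := by
  have hV := slope_pos hs0 hs1 he hn hmn
  have hVp := slope_add_approx_pos hs0 hs1 he hn hmn
  have hQ := slopeSq_pos hs0 hs1 he hn hmn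
  have hV2 : slope s e m n ^ 2 = slopeSq s e m n := Real.sq_sqrt hQ.le
  have hd := slopeSq_sub_sq s e m n
  have hpoly : hessNumer s e m n - 8 * (2 - s) * (3 * slopeApprox s e m * slopeSq s e m n -
      slopeApprox s e m ^ 3) = s ^ 4 *
      (e * (40 - 24 * s + 8 * m + 12 * s * m - 6 * s ^ 2 * m + 8 * m ^ 2 + 2 * s ^ 2 * n) +
    e ^ 3 * (56 - 72 * s + 8 * s ^ 2 + 8 * s ^ 3 +
      n * (8 - 16 * s + 16 * s ^ 2 - 6 * s ^ 3) +
      m * (-8 + 84 * s - 66 * s ^ 2 + 6 * s ^ 4) +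
      m * n * (-2 * s ^ 2 + 4 * s ^ 3 - 3 / 2 * s ^ 4) +
      m ^ 2 * (-8 + 30 * s ^ 2 - 18 * s ^ 3 - 3 / 2 * s ^ 4 + 3 / 2 * s ^ 5) +
      m ^ 3 * (3 * s ^ 3 - 3 / 2 * s ^ 4 - 1 / 4 * s ^ 5 + 1 / 8 * s ^ 6))) := by
    unfold hessNumer slopeApprox slopeSq
    ring
  unfold lowerOrder
  rw [eq_div_of_mul_eq (pow_ne_zero 4 hs) ((mul_comm _ _).trans hpoly.symm)]
  generalize hessNumer s e m n = N at *
  generalize slopeDefect s e m n = τ at *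
  generalize slopeApprox s e m = p at *
  generalize slope s e m n = V at *
  generalize slopeSq s e m n = Q at *
  subst hV2
  have hτ : τ = (V - p) * (V + p) / s ^ 2 := by
    field_simp
    linarith
  subst hτ
  have := hVp.ne'
  field_simp
  ring

/-! ### Second derivatives of the immersion -/

section
variable {S : Set (Fin 2 → ℝ)} {p : Fin 2 → ℝ}

theorem eventually_pd_height {η f fj : (Fin 2 → ℝ) → ℝ} {j : Fin 2} (hS : UniqueDiffOn ℝ S)
    (hη : DifferentiableOn ℝ η S) (hf : ∀ᶠ q in 𝓝[S] p, DifferentiableWithinAt ℝ f S q)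
    (hfj : ∀ᶠ q in 𝓝[S] p, pd S j f q = fj q) :
    ∀ᶠ q in 𝓝[S] p, pd S j (fun q => 2 * Real.exp (η q) * f q) q =
      2 * Real.exp (η q) * (f q * pd S j η q + fj q) := by
  filter_upwards [hf, hfj, self_mem_nhdsWithin] with q h1 h2 h3
  rw [pd_height (hS q h3) (hη q h3) h1, h2]

theorem differentiableWithinAt_pd_height {η f fj : (Fin 2 → ℝ) → ℝ} {j : Fin 2}
    (hS : UniqueDiffOn ℝ S) (hη : ContDiffOn ℝ 2 η S) (hp : p ∈ S)
    (hf : ∀ᶠ q in 𝓝[S] p, DifferentiableWithinAt ℝ f S q)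
    (hfj : ∀ᶠ q in 𝓝[S] p, pd S j f q = fj q) (hfj' : DifferentiableWithinAt ℝ fj S p) :
    DifferentiableWithinAt ℝ (pd S j (fun q => 2 * Real.exp (η q) * f q)) S p := by
  have hη' := hη.differentiableOn (by norm_num)
  have hηp := hη' p hp
  have hd := differentiableWithinAt_pd hS hη hp j
  have hfp := hf.self_of_nhdsWithin hp
  have h := eventually_pd_height hS hη' hf hfj
  refine DifferentiableWithinAt.congr_of_eventuallyEq ?_ h (h.self_of_nhdsWithin hp)
  fun_prop

theorem pd_pd_apply {X : (Fin 2 → ℝ) → Fin 3 → ℝ} {i j : Fin 2} (hS : UniqueDiffOn ℝ S)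
    (hp : p ∈ S) (hX : ∀ᶠ q in 𝓝[S] p, ∀ k, DifferentiableWithinAt ℝ (fun q => X q k) S q)
    (hXd : ∀ k, DifferentiableWithinAt ℝ (pd S j (fun q => X q k)) S p) (k : Fin 3) :
    pd S i (pd S j X) p k = pd S i (pd S j (fun q => X q k)) p := by
  have h : ∀ k, ∀ᶠ q in 𝓝[S] p, pd S j X q k = pd S j (fun q => X q k) q := by
    intro k
    filter_upwards [hX, self_mem_nhdsWithin] with q h1 h2
    exact pd_apply (hS q h2) h1 k
  rw [pd_apply (hS p hp), pd_congr (h k) hp]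
  intro k
  exact (hXd k).congr_of_eventuallyEq (h k) ((h k).self_of_nhdsWithin hp)

theorem hasDerivAt_two_div {t : ℝ} (ht : 1 + t ≠ 0) :
    HasDerivAt (fun t : ℝ => 2 / (1 + t)) (-2 / (1 + t) ^ 2) t := by
  refine ((hasDerivAt_const t (2 : ℝ)).fun_div ((hasDerivAt_id' t).const_add 1) ht).congr_deriv ?_
  simp

theorem hasDerivAt_neg_two_div_sq {t : ℝ} (ht : 1 + t ≠ 0) :
    HasDerivAt (fun t : ℝ => -2 / (1 + t) ^ 2) (4 / (1 + t) ^ 3) t := by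
  refine ((hasDerivAt_const t (-2 : ℝ)).fun_div (((hasDerivAt_id' t).const_add 1).fun_pow 2)
    (pow_ne_zero 2 ht)).congr_deriv ?_
  simp
  field_simp
  ring

theorem hasDerivAt_add_div_sub {t : ℝ} (ht : 1 - t ≠ 0) :
    HasDerivAt (fun t : ℝ => (1 + t) / (1 - t)) (2 / (1 - t) ^ 2) t := by
  refine (((hasDerivAt_id' t).const_add 1).fun_div ((hasDerivAt_id' t).const_sub 1)
    ht).congr_deriv ?_
  simp
  ring

theorem hasDerivAt_two_div_sub_sq {t : ℝ} (ht : 1 - t ≠ 0) :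
    HasDerivAt (fun t : ℝ => 2 / (1 - t) ^ 2) (4 / (1 - t) ^ 3) t := by
  refine ((hasDerivAt_const t (2 : ℝ)).fun_div (((hasDerivAt_id' t).const_sub 1).fun_pow 2)
    (pow_ne_zero 2 ht)).congr_deriv ?_
  simp
  field_simp
  ring

/-! ### Derivatives of the immersion in Cartesian coordinates -/

theorem pd_cartesian_base (hS : UniqueDiffWithinAt ℝ S p) (j k : Fin 2) :
    pd S j (fun q => 2 / (1 + (q 0 ^ 2 + q 1 ^ 2)) * q k) p =
      2 / (1 + (p 0 ^ 2 + p 1 ^ 2)) * (if j = k then 1 else 0) +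
        -2 / (1 + (p 0 ^ 2 + p 1 ^ 2)) ^ 2 * (2 * p j) * p k := by
  have hu : 1 + (p 0 ^ 2 + p 1 ^ 2) ≠ 0 := by positivity
  rw [pd_mul (u := fun q => 2 / (1 + (q 0 ^ 2 + q 1 ^ 2))) hS (by fun_prop (disch := assumption))
    (by fun_prop), pd_coord hS, pd_comp_sq_norm (φ := fun t => 2 / (1 + t)) hS
    (hasDerivAt_two_div hu)]

theorem pd_pd_cartesian_base (hS : UniqueDiffOn ℝ S) (hp : p ∈ S) (i j k : Fin 2) :
    pd S i (pd S j (fun q => 2 / (1 + (q 0 ^ 2 + q 1 ^ 2)) * q k)) p =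
      -2 / (1 + (p 0 ^ 2 + p 1 ^ 2)) ^ 2 * (2 * p i * (if j = k then 1 else 0) +
        2 * p j * (if i = k then 1 else 0) + 2 * p k * (if i = j then 1 else 0)) +
        16 / (1 + (p 0 ^ 2 + p 1 ^ 2)) ^ 3 * p i * p j * p k := by
  have hu : 1 + (p 0 ^ 2 + p 1 ^ 2) ≠ 0 := by positivity
  have hu' : (1 + (p 0 ^ 2 + p 1 ^ 2)) ^ 2 ≠ 0 := by positivity
  have hSp := hS p hp
  rw [pd_congr (v := fun q => 2 / (1 + (q 0 ^ 2 + q 1 ^ 2)) * (if j = k then 1 else 0) +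
        -2 / (1 + (q 0 ^ 2 + q 1 ^ 2)) ^ 2 * (2 * q j * q k)) ?_ hp]
  · rw [pd_add (u := fun q => 2 / (1 + (q 0 ^ 2 + q 1 ^ 2)) * (if j = k then 1 else 0))
        (v := fun q => -2 / (1 + (q 0 ^ 2 + q 1 ^ 2)) ^ 2 * (2 * q j * q k)) hSp
        (by fun_prop (disch := assumption)) (by fun_prop (disch := assumption)),
      pd_mul (u := fun q => 2 / (1 + (q 0 ^ 2 + q 1 ^ 2))) hSp
        (by fun_prop (disch := assumption)) (by fun_prop),
      pd_mul (u := fun q => -2 / (1 + (q 0 ^ 2 + q 1 ^ 2)) ^ 2) hSp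
        (by fun_prop (disch := assumption)) (by fun_prop),
      pd_mul (u := fun q => 2 * q j) hSp (by fun_prop) (by fun_prop),
      pd_mul (u := fun _ => 2) hSp (by fun_prop) (by fun_prop),
      pd_const, pd_const, pd_coord hSp, pd_coord hSp,
      pd_comp_sq_norm (φ := fun t => 2 / (1 + t)) hSp (hasDerivAt_two_div hu),
      pd_comp_sq_norm (φ := fun t => -2 / (1 + t) ^ 2) hSp (hasDerivAt_neg_two_div_sq hu)]
    field_simp
    ring
  · filter_upwards [self_mem_nhdsWithin] with q hq
    rw [pd_cartesian_base (hS q hq)]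
    ring

theorem pd_cartesian_profile (hS : UniqueDiffWithinAt ℝ S p) (hs : 1 - (p 0 ^ 2 + p 1 ^ 2) ≠ 0)
    (j : Fin 2) :
    pd S j (fun q => (1 + (q 0 ^ 2 + q 1 ^ 2)) / (1 - (q 0 ^ 2 + q 1 ^ 2))) p =
      2 / (1 - (p 0 ^ 2 + p 1 ^ 2)) ^ 2 * (2 * p j) :=
  pd_comp_sq_norm (φ := fun t => (1 + t) / (1 - t)) hS (hasDerivAt_add_div_sub hs)

theorem pd_pd_cartesian_profile (hS : UniqueDiffWithinAt ℝ S p)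
    (hs : 1 - (p 0 ^ 2 + p 1 ^ 2) ≠ 0) (i j : Fin 2) :
    pd S i (fun q => 2 / (1 - (q 0 ^ 2 + q 1 ^ 2)) ^ 2 * (2 * q j)) p =
      4 / (1 - (p 0 ^ 2 + p 1 ^ 2)) ^ 2 * (if i = j then 1 else 0) +
        16 / (1 - (p 0 ^ 2 + p 1 ^ 2)) ^ 3 * p i * p j := by
  have hs' := pow_ne_zero 2 hs
  rw [pd_mul (u := fun q => 2 / (1 - (q 0 ^ 2 + q 1 ^ 2)) ^ 2) hS
      (by fun_prop (disch := assumption)) (by fun_prop),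
    pd_mul (u := fun _ => 2) hS (by fun_prop) (by fun_prop), pd_const, pd_coord hS,
    pd_comp_sq_norm (φ := fun t => 2 / (1 - t) ^ 2) hS (hasDerivAt_two_div_sub_sq hs)]
  ring

/-! ### Derivatives of the immersion in polar coordinates -/

theorem hasDerivAt_two_mul_div {t : ℝ} :
    HasDerivAt (fun t : ℝ => 2 * t / (1 + t ^ 2)) (2 * (1 - t ^ 2) / (1 + t ^ 2) ^ 2) t := by
  have ht : 1 + t ^ 2 ≠ 0 := by positivity
  refine (((hasDerivAt_id' t).const_mul 2).fun_div ((hasDerivAt_pow 2 t).const_add 1)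
    ht).congr_deriv ?_
  simp
  ring

theorem hasDerivAt_two_mul_sub_div_sq {t : ℝ} :
    HasDerivAt (fun t : ℝ => 2 * (1 - t ^ 2) / (1 + t ^ 2) ^ 2)
      (-4 * t * (3 - t ^ 2) / (1 + t ^ 2) ^ 3) t := by
  have ht : (1 + t ^ 2) ^ 2 ≠ 0 := by positivity
  refine ((((hasDerivAt_pow 2 t).const_sub 1).const_mul 2).fun_div
    (((hasDerivAt_pow 2 t).const_add 1).fun_pow 2) ht).congr_deriv ?_
  simp
  field_simp
  ring

/-- First derivatives of a product `φ(r) ψ(θ)`. -/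
theorem pd_polar_mul (hS : UniqueDiffWithinAt ℝ S p) {φ ψ φ' ψ' : ℝ → ℝ}
    (hφ : ∀ t, HasDerivAt φ (φ' t) t) (hψ : ∀ t, HasDerivAt ψ (ψ' t) t) (j : Fin 2) :
    pd S j (fun q => φ (q 0) * ψ (q 1)) p =
      ![φ' (p 0) * ψ (p 1), φ (p 0) * ψ' (p 1)] j := by
  have h0 : DifferentiableWithinAt ℝ (fun q : Fin 2 → ℝ => φ (q 0)) S p :=
    (hφ _).differentiableAt.comp_differentiableWithinAt p (f := fun q : Fin 2 → ℝ => q 0)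
      (by fun_prop)
  have h1 : DifferentiableWithinAt ℝ (fun q : Fin 2 → ℝ => ψ (q 1)) S p :=
    (hψ _).differentiableAt.comp_differentiableWithinAt p (f := fun q : Fin 2 → ℝ => q 1)
      (by fun_prop)
  rw [pd_mul (u := fun q => φ (q 0)) (v := fun q => ψ (q 1)) hS h0 h1, pd_comp_coord hS (hφ _),
    pd_comp_coord hS (hψ _)]
  fin_cases j <;> simp

/-- Second derivatives of a product `φ(r) ψ(θ)`. -/
theorem pd_pd_polar_mul (hS : UniqueDiffOn ℝ S) (hp : p ∈ S) {φ ψ φ' ψ' φ'' ψ'' : ℝ → ℝ}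
    (hφ : ∀ t, HasDerivAt φ (φ' t) t) (hψ : ∀ t, HasDerivAt ψ (ψ' t) t)
    (hφ' : ∀ t, HasDerivAt φ' (φ'' t) t) (hψ' : ∀ t, HasDerivAt ψ' (ψ'' t) t) (i j : Fin 2) :
    DifferentiableWithinAt ℝ (pd S j (fun q => φ (q 0) * ψ (q 1))) S p ∧
    pd S i (pd S j (fun q => φ (q 0) * ψ (q 1))) p =
      ![![φ'' (p 0) * ψ (p 1), φ' (p 0) * ψ' (p 1)],
        ![φ' (p 0) * ψ' (p 1), φ (p 0) * ψ'' (p 1)]] i j := by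
  have h : ∀ᶠ q in 𝓝[S] p, pd S j (fun q => φ (q 0) * ψ (q 1)) q =
      ![φ' (q 0) * ψ (q 1), φ (q 0) * ψ' (q 1)] j := by
    filter_upwards [self_mem_nhdsWithin] with q hq
    exact pd_polar_mul (hS q hq) hφ hψ j
  have hd : ∀ f : ℝ → ℝ, Differentiable ℝ f → ∀ k : Fin 2,
      DifferentiableWithinAt ℝ (fun q : Fin 2 → ℝ => f (q k)) S p := by
    intro f hf k
    fun_prop
  have d1 := hd φ (fun t => (hφ t).differentiableAt) 0
  have d2 := hd ψ (fun t => (hψ t).differentiableAt) 1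
  have d3 := hd φ' (fun t => (hφ' t).differentiableAt) 0
  have d4 := hd ψ' (fun t => (hψ' t).differentiableAt) 1
  constructor
  · refine DifferentiableWithinAt.congr_of_eventuallyEq ?_ h (h.self_of_nhdsWithin hp)
    fin_cases j
    · exact d3.mul d2
    · exact d1.mul d4
  · rw [pd_congr h hp]
    fin_cases j
    · refine (pd_polar_mul (hS p hp) hφ' hψ i).trans ?_
      fin_cases i <;> simp
    · refine (pd_polar_mul (hS p hp) hφ hψ' i).trans ?_
      fin_cases i <;> simp

end

/-! ### The covariant Hessian of the height in Cartesian coordinates -/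

/-- Base Christoffel symbols in Cartesian coordinates: those of the pullback of the disk metric
under `z ↦ 2z / (1 + |z|²)`, with `s = 1 - |z|²` and `u = 1 + |z|²`. -/
def cartesianChristoffel (s u : ℝ) (z : Fin 2 → ℝ) (k i j : Fin 2) : ℝ :=
  2 * (4 - s) / (s * u) * (z i * (if j = k then 1 else 0) + z j * (if i = k then 1 else 0)) -
    2 * (s ^ 2 + 4 * u) / s ^ 3 * (if i = j then 1 else 0) * z k +
    32 / (s ^ 3 * u) * z i * z j * z k

/-- The covariant derivatives of the coordinate vector fields `a i` of the base map
`z ↦ 2z / (1 + |z|²)` have the coefficients `cartesianChristoffel` in the frame `a`. -/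
theorem cartesian_base_hessian {s u : ℝ} {z : Fin 2 → ℝ} (hs : 1 - (z 0 ^ 2 + z 1 ^ 2) = s)
    (hu : 1 + (z 0 ^ 2 + z 1 ^ 2) = u) (hs0 : s ≠ 0) (hu0 : u ≠ 0) (i j k : Fin 2)
    {a : Fin 2 → Fin 2 → ℝ}
    (ha : ∀ i k, a i k = 2 / u * (if i = k then 1 else 0) + -2 / u ^ 2 * (2 * z i) * z k) :
    -2 / u ^ 2 * (2 * z i * (if j = k then 1 else 0) + 2 * z j * (if i = k then 1 else 0) +
        2 * z k * (if i = j then 1 else 0)) + 16 / u ^ 3 * z i * z j * z k +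
      2 / (s ^ 2 / u ^ 2) * ((2 / u * z 0 * a i 0 + 2 / u * z 1 * a i 1) * a j k +
        (2 / u * z 0 * a j 0 + 2 / u * z 1 * a j 1) * a i k -
        (a i 0 * a j 0 + a i 1 * a j 1) * (2 / u * z k)) =
      cartesianChristoffel s u z 0 i j * a 0 k + cartesianChristoffel s u z 1 i j * a 1 k := by
  have h1 : ∀ i, 2 / u * z 0 * a i 0 + 2 / u * z 1 * a i 1 = 4 * s * z i / u ^ 3 := by
    intro i
    rw [ha, ha]
    fin_cases i <;> simp <;> field_simp <;> subst hs <;> subst hu <;> ring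
  have h2 : a i 0 * a j 0 + a i 1 * a j 1 =
      4 / u ^ 2 * (if i = j then 1 else 0) - 16 / u ^ 4 * z i * z j := by
    rw [ha, ha, ha, ha]
    fin_cases i <;> fin_cases j <;> simp <;> field_simp <;> subst hs <;> subst hu <;> ring
  rw [h1, h1, h2]
  simp only [ha, cartesianChristoffel]
  fin_cases i <;> fin_cases j <;> fin_cases k <;> simp <;> field_simp <;> subst hs <;> subst hu <;>
    ring

/-- The covariant Hessian of the height `2 e^η u / s`, where `d` and `w` are the first and second
derivatives of `η`: apart from the term with `w`, it is a polynomial multiplied by `2 e^η / s⁵`. -/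
theorem cartesian_height_hessian {s u e : ℝ} {z : Fin 2 → ℝ} (hs : 1 - (z 0 ^ 2 + z 1 ^ 2) = s)
    (hu : 1 + (z 0 ^ 2 + z 1 ^ 2) = u) (hs0 : s ≠ 0) (hu0 : u ≠ 0) (i j : Fin 2)
    {d : Fin 2 → ℝ} {h : Fin 2 → ℝ} (hh : ∀ i, h i = 2 * e / s ^ 2 * (u * s * d i + 4 * z i))
    {w : ℝ} :
    2 * e * (u / s * d i * d j + u / s * w + 2 / s ^ 2 * (2 * z i) * d j +
        d i * (2 / s ^ 2 * (2 * z j)) +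
        (4 / s ^ 2 * (if i = j then 1 else 0) + 16 / s ^ 3 * z i * z j)) -
      (cartesianChristoffel s u z 0 i j * h 0 + cartesianChristoffel s u z 1 i j * h 1) =
    2 * e * u / s * w + 2 * e / s ^ 5 * (u * s ^ 4 * d i * d j -
      2 * u * s ^ 3 * (z i * d j + z j * d i) -
      32 * (u + s * (z 0 * d 0 + z 1 * d 1)) * z i * z j +
      (if i = j then 1 else 0) * u * (4 * s ^ 2 - 32 * s + 32 +
        2 * (s ^ 2 - 4 * s + 8) * s * (z 0 * d 0 + z 1 * d 1))) := by
  simp only [hh, cartesianChristoffel]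
  fin_cases i <;> fin_cases j <;> simp <;> field_simp <;> subst hs <;> subst hu <;> ring

/-- The contraction of the remainder `P` of the covariant Hessian of the height with the symbol is
rotation invariant: it is a function of `|z|²`, `e^η`, `z · Dη` and `|Dη|²`. -/
theorem cartesian_contraction {s u e x y d₀ d₁ : ℝ} (hs : 1 - (x ^ 2 + y ^ 2) = s)
    (hu : 1 + (x ^ 2 + y ^ 2) = u) {P : Fin 2 → Fin 2 → ℝ} {m q Y₀ Y₁ : ℝ}
    (hY₀ : Y₀ = u * s * d₀ + 4 * x) (hY₁ : Y₁ = u * s * d₁ + 4 * y) (hm : m = x * d₀ + y * d₁)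
    (hq : q = 4 * s ^ 2 - 32 * s + 32 + 2 * (s ^ 2 - 4 * s + 8) * s * m)
    (h00 : P 0 0 = u * s ^ 4 * d₀ * d₀ - 2 * u * s ^ 3 * (x * d₀ + x * d₀) -
      32 * (u + s * m) * x * x + u * q)
    (h01 : P 0 1 = u * s ^ 4 * d₀ * d₁ - 2 * u * s ^ 3 * (x * d₁ + y * d₀) -
      32 * (u + s * m) * x * y)
    (h10 : P 1 0 = u * s ^ 4 * d₁ * d₀ - 2 * u * s ^ 3 * (y * d₀ + x * d₁) -
      32 * (u + s * m) * y * x)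
    (h11 : P 1 1 = u * s ^ 4 * d₁ * d₁ - 2 * u * s ^ 3 * (y * d₁ + y * d₁) -
      32 * (u + s * m) * y * y + u * q) :
    2 * e * ((s ^ 2 + 4 * x ^ 2 + e ^ 2 / 4 * Y₁ ^ 2) * P 0 0 +
      (4 * x * y - e ^ 2 / 4 * (Y₀ * Y₁)) * (P 0 1 + P 1 0) +
      (s ^ 2 + 4 * y ^ 2 + e ^ 2 / 4 * Y₀ ^ 2) * P 1 1) =
      u * hessNumer s e m (d₀ ^ 2 + d₁ ^ 2) := by
  rw [h00, h01, h10, h11, hessNumer, hq, hY₀, hY₁, hm]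
  subst hs hu
  ring

/-! ### The mean curvature operator as a function of the 2-jet -/

/-- `1 - |z|²` in the coordinates of the chart. -/
def Chart.defect : Chart → (Fin 2 → ℝ) → ℝ
  | .polar, x => 1 - x 0 ^ 2
  | .cartesian, x => 1 - (x 0 ^ 2 + x 1 ^ 2)

/-- The Jacobian of the chart. -/
def Chart.jacobian : Chart → (Fin 2 → ℝ) → ℝ
  | .polar, x => x 0
  | .cartesian, _ => 1

/-- The radial derivative `z · Dη` in terms of the coordinate derivatives `d` of `η`. -/
def Chart.radial : Chart → (Fin 2 → ℝ) → (Fin 2 → ℝ) → ℝ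
  | .polar, x, d => x 0 * d 0
  | .cartesian, x, d => x 0 * d 0 + x 1 * d 1

/-- The Euclidean `|Dη|²` in terms of the coordinate derivatives `d` of `η`. -/
def Chart.gradSq : Chart → (Fin 2 → ℝ) → (Fin 2 → ℝ) → ℝ
  | .polar, x, d => d 0 ^ 2 + d 1 ^ 2 / x 0 ^ 2
  | .cartesian, _, d => d 0 ^ 2 + d 1 ^ 2

/-- `slopeSq` as a function of the 1-jet. -/
def Chart.slopeSq (c : Chart) (x : Fin 2 → ℝ) (J : Jet1) : ℝ :=
  H2R.slopeSq (c.defect x) (Real.exp J.1) (c.radial x J.2) (c.gradSq x J.2)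

/-- `slope` as a function of the 1-jet. -/
def Chart.slope (c : Chart) (x : Fin 2 → ℝ) (J : Jet1) : ℝ :=
  H2R.slope (c.defect x) (Real.exp J.1) (c.radial x J.2) (c.gradSq x J.2)

/-- The coefficient matrix of the second derivatives in `√|g| (2H - 1)`, up to the factor
`2 e^η / slopeSq`. It is the adjugate of the matrix of the induced metric, rescaled by
`(1 - |z|²)⁴ / 16` (and by `1 / r` in polar coordinates) so as to be regular at `|z| = 1`. -/
def Chart.symbol : Chart → Fin 2 → Fin 2 → (Fin 2 → ℝ) → Jet1 → ℝ
  | .polar, i, j, x, J =>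
    let s := 1 - x 0 ^ 2
    let u := 1 + x 0 ^ 2
    let Y₀ := u * s * J.2 0 + 4 * x 0
    let Y₁ := u * s * J.2 1
    ![![x 0 * u ^ 2 + Real.exp J.1 ^ 2 / 4 * Y₁ ^ 2 / x 0,
        -(Real.exp J.1 ^ 2 / 4 * (Y₀ * Y₁) / x 0)],
      ![-(Real.exp J.1 ^ 2 / 4 * (Y₀ * Y₁) / x 0),
        s ^ 2 / x 0 + Real.exp J.1 ^ 2 / 4 * Y₀ ^ 2 / x 0]] i j
  | .cartesian, i, j, x, J =>
    let s := 1 - (x 0 ^ 2 + x 1 ^ 2)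
    let u := 1 + (x 0 ^ 2 + x 1 ^ 2)
    let Y₀ := u * s * J.2 0 + 4 * x 0
    let Y₁ := u * s * J.2 1 + 4 * x 1
    ![![s ^ 2 + 4 * x 0 ^ 2 + Real.exp J.1 ^ 2 / 4 * Y₁ ^ 2,
        4 * x 0 * x 1 - Real.exp J.1 ^ 2 / 4 * (Y₀ * Y₁)],
      ![4 * x 0 * x 1 - Real.exp J.1 ^ 2 / 4 * (Y₀ * Y₁),
        s ^ 2 + 4 * x 1 ^ 2 + Real.exp J.1 ^ 2 / 4 * Y₀ ^ 2]] i j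

/-- The coefficients of the second derivatives in `√|g| (2H - 1)`. -/
def Chart.principal (c : Chart) (i j : Fin 2) (x : Fin 2 → ℝ) (J : Jet1) : ℝ :=
  2 * Real.exp J.1 * c.symbol i j x J / c.slopeSq x J

/-- The terms without second derivatives in `√|g| (2H - 1)`. In polar coordinates the Euclidean
Hessian contributes the terms with the Christoffel symbols of `dr² + r² dθ²`. -/
def Chart.lower : Chart → (Fin 2 → ℝ) → Jet1 → ℝ
  | .polar, x, J =>
    x 0 * lowerOrder (Chart.polar.defect x) (Real.exp J.1) (Chart.polar.radial x J.2)
        (Chart.polar.gradSq x J.2) -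
      2 * Chart.polar.principal 0 1 x J * J.2 1 / x 0 +
      Chart.polar.principal 1 1 x J * (x 0 * J.2 0)
  | .cartesian, x, J =>
    lowerOrder (Chart.cartesian.defect x) (Real.exp J.1) (Chart.cartesian.radial x J.2)
      (Chart.cartesian.gradSq x J.2)

/-- The expression `√|g| (2H - 1)` as a function of the 2-jet of `η`. The formula makes sense on
the whole closed domain, including `|z| = 1`, where neither `√|g|` nor the immersion is defined. -/
def Chart.rescaledDefect (c : Chart) (x : Fin 2 → ℝ) (J : Jet2) : ℝ :=
  ∑ i, ∑ j, c.principal i j x (J.1, J.2.1) * J.2.2 i j + c.lower x (J.1, J.2.1)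

theorem Chart.symbol_comm (c : Chart) (i j : Fin 2) (x : Fin 2 → ℝ) (J : Jet1) :
    c.symbol i j x J = c.symbol j i x J := by
  cases c <;> fin_cases i <;> fin_cases j <;> rfl

/-! ### The operator in Cartesian coordinates -/

/-- The 2-jet of the immersion in Cartesian coordinates. -/
theorem cartesian_surface_jets {S : Set (Fin 2 → ℝ)} {p : Fin 2 → ℝ} {η : (Fin 2 → ℝ) → ℝ}
    (hS : UniqueDiffOn ℝ S) (hp : p ∈ S) (hη : ContDiffOn ℝ 2 η S) {s u e : ℝ}
    (hs' : 1 - (p 0 ^ 2 + p 1 ^ 2) = s) (hu : 1 + (p 0 ^ 2 + p 1 ^ 2) = u) (hs : 0 < s)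
    (he : Real.exp (η p) = e) {a k : Fin 2 → Fin 2 → ℝ} {d h : Fin 2 → ℝ}
    (hd : ∀ i, pd S i η p = d i)
    (ha : ∀ i k, a i k = 2 / u * (if i = k then 1 else 0) + -2 / u ^ 2 * (2 * p i) * p k)
    (hh : ∀ i, h i = 2 * e / s ^ 2 * (u * s * d i + 4 * p i))
    (hk : ∀ i j, k i j =
      2 * e * (u / s * d i * d j + u / s * pd S i (pd S j η) p + 2 / s ^ 2 * (2 * p i) * d j +
        d i * (2 / s ^ 2 * (2 * p j)) +
        (4 / s ^ 2 * (if i = j then 1 else 0) + 16 / s ^ 3 * p i * p j))) :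
    1 - (Chart.cartesian.surface η p 0 ^ 2 + Chart.cartesian.surface η p 1 ^ 2) = s ^ 2 / u ^ 2 ∧
    (∀ i, pd S i (Chart.cartesian.surface η) p = ![a i 0, a i 1, h i]) ∧
    ∀ i j, covDeriv S (Chart.cartesian.surface η) i j p =
      ![cartesianChristoffel s u p 0 i j * a 0 0 + cartesianChristoffel s u p 1 i j * a 1 0,
        cartesianChristoffel s u p 0 i j * a 0 1 + cartesianChristoffel s u p 1 i j * a 1 1,
        k i j] := by
  have hu0 : 0 < u := by rw [← hu]; positivity
  have hSp := hS p hp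
  have hη1 := hη.differentiableOn (by norm_num)
  -- the components of the immersion and their derivatives
  set X := Chart.cartesian.surface η with hX
  set f : (Fin 2 → ℝ) → ℝ := fun q => (1 + (q 0 ^ 2 + q 1 ^ 2)) / (1 - (q 0 ^ 2 + q 1 ^ 2)) with hf
  have hsne : ∀ᶠ q in 𝓝[S] p, 1 - (q 0 ^ 2 + q 1 ^ 2) ≠ 0 := by
    have : ContinuousWithinAt (fun q : Fin 2 → ℝ => 1 - (q 0 ^ 2 + q 1 ^ 2)) S p := by fun_prop
    exact this.eventually_ne (hs'.trans_ne hs.ne')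
  have hfd : ∀ᶠ q in 𝓝[S] p, DifferentiableWithinAt ℝ f S q := by
    filter_upwards [hsne] with q hq
    fun_prop (disch := assumption)
  have hfj : ∀ j, ∀ᶠ q in 𝓝[S] p,
      pd S j f q = 2 / (1 - (q 0 ^ 2 + q 1 ^ 2)) ^ 2 * (2 * q j) := by
    intro j
    filter_upwards [hsne, self_mem_nhdsWithin] with q hq hqS
    exact pd_cartesian_profile (hS q hqS) hq j
  have hsp : 1 - (p 0 ^ 2 + p 1 ^ 2) ≠ 0 := hsne.self_of_nhdsWithin hp
  have hsp2 := pow_ne_zero 2 hsp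
  have hfj' : ∀ j, DifferentiableWithinAt ℝ
      (fun q : Fin 2 → ℝ => 2 / (1 - (q 0 ^ 2 + q 1 ^ 2)) ^ 2 * (2 * q j)) S p := by
    intro j
    fun_prop (disch := assumption)
  have hX0 : (fun q => X q 0) = fun q => 2 / (1 + (q 0 ^ 2 + q 1 ^ 2)) * q 0 := rfl
  have hX1 : (fun q => X q 1) = fun q => 2 / (1 + (q 0 ^ 2 + q 1 ^ 2)) * q 1 := rfl
  have hX2 : (fun q => X q 2) = fun q => 2 * Real.exp (η q) * f q := rfl
  have hbase : ∀ k : Fin 2, ∀ q, DifferentiableWithinAt ℝ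
      (fun q : Fin 2 → ℝ => 2 / (1 + (q 0 ^ 2 + q 1 ^ 2)) * q k) S q := by
    intro k q
    have : 1 + (q 0 ^ 2 + q 1 ^ 2) ≠ 0 := by positivity
    fun_prop (disch := assumption)
  have hXd : ∀ᶠ q in 𝓝[S] p, ∀ k, DifferentiableWithinAt ℝ (fun q => X q k) S q := by
    filter_upwards [hfd, self_mem_nhdsWithin] with q hq hqS k
    have hηq := hη1 q hqS
    fin_cases k
    · exact hbase 0 q
    · exact hbase 1 q
    · change DifferentiableWithinAt ℝ (fun q => 2 * Real.exp (η q) * f q) S q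
      fun_prop
  have hbase' : ∀ j k : Fin 2, DifferentiableWithinAt ℝ
      (pd S j (fun q : Fin 2 → ℝ => 2 / (1 + (q 0 ^ 2 + q 1 ^ 2)) * q k)) S p := by
    intro j k
    refine differentiableWithinAt_pd hS (ContDiff.contDiffOn ?_) hp j
    have : ∀ q : Fin 2 → ℝ, 1 + (q 0 ^ 2 + q 1 ^ 2) ≠ 0 := fun q => by positivity
    fun_prop (disch := assumption)
  have hXdd : ∀ j k, DifferentiableWithinAt ℝ (pd S j (fun q => X q k)) S p := by
    intro j k
    fin_cases k
    · exact hbase' j 0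
    · exact hbase' j 1
    · exact differentiableWithinAt_pd_height hS hη hp hfd (hfj j) (hfj' j)
  have hpdX : ∀ i, pd S i X p = ![a i 0, a i 1, h i] := by
    intro i
    have hap := pd_apply (i := i) hSp (hXd.self_of_nhdsWithin hp)
    funext k
    fin_cases k
    · refine (hap 0).trans ?_
      rw [hX0, pd_cartesian_base hSp, hu]
      exact (ha i 0).symm
    · refine (hap 1).trans ?_
      rw [hX1, pd_cartesian_base hSp, hu]
      exact (ha i 1).symm
    · refine (hap 2).trans ?_
      rw [hX2, pd_height hSp (hη1 p hp) (hfd.self_of_nhdsWithin hp),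
        (hfj i).self_of_nhdsWithin hp]
      refine Eq.trans ?_ (hh i).symm
      simp only [hf, hu, hs', hd, he]
      field_simp
      ring
  have hXp0 : X p 0 = 2 / u * p 0 := by rw [← hu]; rfl
  have hXp1 : X p 1 = 2 / u * p 1 := by rw [← hu]; rfl
  have hD : 1 - (X p 0 ^ 2 + X p 1 ^ 2) = s ^ 2 / u ^ 2 := by
    rw [hXp0, hXp1]
    field_simp
    rw [← hs', ← hu]
    ring
  have hD0 : s ^ 2 / u ^ 2 ≠ 0 := by positivity
  have hcov : ∀ i j, covDeriv S X i j p =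
      ![cartesianChristoffel s u p 0 i j * a 0 0 + cartesianChristoffel s u p 1 i j * a 1 0,
        cartesianChristoffel s u p 0 i j * a 0 1 + cartesianChristoffel s u p 1 i j * a 1 1,
        k i j] := by
    intro i j
    have hpp := pd_pd_apply (i := i) (j := j) hS hp hXd (hXdd j)
    funext l
    rw [covDeriv, sum_christoffel _ (hD ▸ hD0), hD, hpp, hpdX, hpdX, hXp0, hXp1]
    fin_cases l
    · refine Eq.trans ?_ (cartesian_base_hessian hs' hu hs.ne' hu0.ne' i j 0 ha)
      simp only [Fin.zero_eta, hX0, pd_pd_cartesian_base hS hp, hu]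
      rfl
    · refine Eq.trans ?_ (cartesian_base_hessian hs' hu hs.ne' hu0.ne' i j 1 ha)
      simp only [Fin.mk_one, hX1, pd_pd_cartesian_base hS hp, hu]
      rfl
    · refine Eq.trans ?_ (hk i j).symm
      simp only [Fin.reduceFinMk, hX2]
      rw [pd_pd_height hS hη hp hfd (hfj j) (hfj' j), (hfj i).self_of_nhdsWithin hp,
        pd_pd_cartesian_profile hSp hsp]
      simp only [hf, hu, hs', hd, he]
      exact add_zero _
  exact ⟨hD, hpdX, hcov⟩

/-- The last step of the computation of `√|g| (2H - 1)`: the matrix `A` is, up to scaling, the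
adjugate of that of the induced metric, `δ` is the Jacobian of the chart, and `K` is the covariant
Hessian of the height, which is split into its second-order part `w` and the rest `E`. -/
theorem rescale_meanCurvature {s u e V δ H : ℝ} {A K w E : Fin 2 → Fin 2 → ℝ} (hs : 0 < s)
    (hu : 0 < u) (hV : 0 < V) (hδ : 0 < δ) (hK : ∀ i j, K i j = 2 * e * u / s * w i j + E i j)
    (hA : A 1 0 = A 0 1)
    (hH : H = 1 / 2 * ((δ * (16 / s ^ 4 * A 0 0) * K 0 0 -
      -(δ * (16 / s ^ 4 * A 0 1)) * (K 0 1 + K 1 0) + δ * (16 / s ^ 4 * A 1 1) * K 1 1) /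
        ((δ * (16 * u * V / s ^ 4)) ^ 2 * (V / s)))) :
    δ * (16 * u * V / s ^ 4) * (2 * H - 1) =
      ∑ i, ∑ j, 2 * e * A i j / V ^ 2 * w i j +
        (s / (u * V ^ 2) * (A 0 0 * E 0 0 + A 0 1 * (E 0 1 + E 1 0) + A 1 1 * E 1 1) -
          δ * (16 * u * V / s ^ 4)) := by
  simp only [Fin.sum_univ_two]
  rw [hH, hA, hK, hK, hK, hK]
  field_simp
  ring

/-- In Cartesian coordinates, `√|g| = 16 (1 + |z|²) V / (1 - |z|²)⁴` with `V` the slope, and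
`√|g| (2H - 1)` is the function `rescaledDefect` of the 2-jet. -/
theorem cartesian_operator {S : Set (Fin 2 → ℝ)} {p : Fin 2 → ℝ} {η : (Fin 2 → ℝ) → ℝ}
    (hS : UniqueDiffOn ℝ S) (hp : p ∈ S) (hs : 0 < Chart.cartesian.defect p)
    (hη : ContDiffOn ℝ 2 η S) :
    (inducedMetric S (Chart.cartesian.surface η) p).det =
      (16 * (2 - Chart.cartesian.defect p) * Chart.cartesian.slope p (jet1 S η p) /
        Chart.cartesian.defect p ^ 4) ^ 2 ∧
    16 * (2 - Chart.cartesian.defect p) * Chart.cartesian.slope p (jet1 S η p) /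
        Chart.cartesian.defect p ^ 4 *
        (2 * meanCurvature S (Chart.cartesian.surface η) p - 1) =
      Chart.cartesian.rescaledDefect p (jet2 S η p) := by
  set s := Chart.cartesian.defect p with hs_def
  have hs' : 1 - (p 0 ^ 2 + p 1 ^ 2) = s := rfl
  obtain ⟨u, hu⟩ : ∃ u, 1 + (p 0 ^ 2 + p 1 ^ 2) = u := ⟨_, rfl⟩
  have hus : u = 2 - s := by linarith
  have hu0 : 0 < u := by rw [← hu]; positivity
  have hs1 : s ≤ 1 := by nlinarith [sq_nonneg (p 0), sq_nonneg (p 1)]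
  set d : Fin 2 → ℝ := fun i => pd S i η p with hd
  set e := Real.exp (η p) with he
  have he0 : 0 < e := Real.exp_pos _
  set m := p 0 * d 0 + p 1 * d 1 with hm
  have hn : 0 ≤ d 0 ^ 2 + d 1 ^ 2 := by positivity
  have hmn : m ^ 2 ≤ (1 - s) * (d 0 ^ 2 + d 1 ^ 2) := by
    rw [← hs']
    nlinarith [sq_nonneg (p 0 * d 1 - p 1 * d 0)]
  set V := Chart.cartesian.slope p (jet1 S η p) with hV
  have hV0 : 0 < V := slope_pos hs.le hs1 he0 hn hmn
  have hV2 : V ^ 2 = H2R.slopeSq s e m (d 0 ^ 2 + d 1 ^ 2) :=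
    Real.sq_sqrt (slopeSq_pos hs.le hs1 he0 hn hmn).le
  have hV2' : Chart.cartesian.slopeSq p (jet1 S η p) = V ^ 2 := hV2.symm
  obtain ⟨a, ha⟩ : ∃ a : Fin 2 → Fin 2 → ℝ, ∀ i k, a i k =
      2 / u * (if i = k then 1 else 0) + -2 / u ^ 2 * (2 * p i) * p k := ⟨_, fun _ _ => rfl⟩
  obtain ⟨h, hh⟩ : ∃ h : Fin 2 → ℝ, ∀ i, h i = 2 * e / s ^ 2 * (u * s * d i + 4 * p i) :=
    ⟨_, fun _ => rfl⟩
  obtain ⟨k, hk⟩ : ∃ k : Fin 2 → Fin 2 → ℝ, ∀ i j, k i j =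
      2 * e * (u / s * d i * d j + u / s * pd S i (pd S j η) p + 2 / s ^ 2 * (2 * p i) * d j +
        d i * (2 / s ^ 2 * (2 * p j)) +
        (4 / s ^ 2 * (if i = j then 1 else 0) + 16 / s ^ 3 * p i * p j)) := ⟨_, fun _ _ => rfl⟩
  obtain ⟨hD, hpdX, hcov⟩ := cartesian_surface_jets hS hp hη hs' hu hs rfl (fun _ => rfl) ha hh hk
  have hD0 : s ^ 2 / u ^ 2 ≠ 0 := by positivity
  have hJ : a 0 0 * a 1 1 - a 0 1 * a 1 0 = 4 * s / u ^ 3 := by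
    simp only [ha]
    simp
    field_simp
    rw [← hs', ← hu]
    ring
  have hW : (s ^ 2 / u ^ 2) ^ 2 / 4 * ((a 0 1 * h 1 - h 0 * a 1 1) ^ 2 +
      (h 0 * a 1 0 - a 0 0 * h 1) ^ 2) + (4 * s / u ^ 3) ^ 2 = (4 * s / u ^ 3 * (V / s)) ^ 2 := by
    have e1 : (4 * s / u ^ 3 * (V / s)) ^ 2 = 16 / u ^ 6 * V ^ 2 := by field_simp; ring
    rw [e1, hV2, H2R.slopeSq, hm]
    simp only [ha, hh]
    simp
    field_simp
    rw [← hs', ← hu]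
    ring
  obtain ⟨hdet, hH⟩ := meanCurvature_graph hD hD0 (by positivity) (div_pos hV0 hs) hpdX hcov hJ hW
  have hscale : 4 / (s ^ 2 / u ^ 2) ^ 2 * (4 * s / u ^ 3) * (V / s) = 16 * u * V / s ^ 4 := by
    field_simp
    ring
  rw [hscale] at hdet hH
  rw [← hus]
  refine ⟨hdet, ?_⟩
  -- the matrix of the induced metric is the adjugate of the symbol, up to scaling
  have g11 : 4 / (s ^ 2 / u ^ 2) ^ 2 * (a 1 0 ^ 2 + a 1 1 ^ 2) + h 1 ^ 2 =
      16 / s ^ 4 * Chart.cartesian.symbol 0 0 p (jet1 S η p) := by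
    simp only [ha, hh, Chart.symbol, jet1, hs', hu]
    simp
    field_simp
    rw [← hs', ← hu]
    ring
  have g01 : 4 / (s ^ 2 / u ^ 2) ^ 2 * (a 0 0 * a 1 0 + a 0 1 * a 1 1) + h 0 * h 1 =
      -(16 / s ^ 4 * Chart.cartesian.symbol 0 1 p (jet1 S η p)) := by
    simp only [ha, hh, Chart.symbol, jet1, hs', hu]
    simp
    field_simp
    rw [← hs', ← hu]
    ring
  have g00 : 4 / (s ^ 2 / u ^ 2) ^ 2 * (a 0 0 ^ 2 + a 0 1 ^ 2) + h 0 ^ 2 =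
      16 / s ^ 4 * Chart.cartesian.symbol 1 1 p (jet1 S η p) := by
    simp only [ha, hh, Chart.symbol, jet1, hs', hu]
    simp
    field_simp
    rw [← hs', ← hu]
    ring
  rw [g11, g01, g00] at hH
  have hess := fun i j => cartesian_height_hessian hs' hu hs.ne' hu0.ne' i j hh
    (w := pd S i (pd S j η) p) (d := d) (e := e)
  simp only [← hk, ← hm] at hess
  obtain ⟨P, hP⟩ : ∃ P : Fin 2 → Fin 2 → ℝ, ∀ i j, P i j = u * s ^ 4 * d i * d j -
      2 * u * s ^ 3 * (p i * d j + p j * d i) - 32 * (u + s * m) * p i * p j +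
      (if i = j then 1 else 0) * u * (4 * s ^ 2 - 32 * s + 32 +
        2 * (s ^ 2 - 4 * s + 8) * s * m) := ⟨_, fun _ _ => rfl⟩
  simp only [← hP] at hess
  have hcontr := cartesian_contraction (e := e) hs' hu (P := P) rfl rfl hm rfl
    (by rw [hP]; simp) (by rw [hP]; simp) (by rw [hP]; simp) (by rw [hP]; simp)
  have hcontr' : 2 * e * (Chart.cartesian.symbol 0 0 p (jet1 S η p) * P 0 0 +
      Chart.cartesian.symbol 0 1 p (jet1 S η p) * (P 0 1 + P 1 0) +
      Chart.cartesian.symbol 1 1 p (jet1 S η p) * P 1 1) =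
      u * hessNumer s e m (d 0 ^ 2 + d 1 ^ 2) := by
    rw [← hcontr]
    simp only [Chart.symbol, jet1, hs', hu]
    simp [hd]
    exact Or.inl rfl
  have hlow : Chart.cartesian.lower p (jet1 S η p) =
      hessNumer s e m (d 0 ^ 2 + d 1 ^ 2) / (s ^ 4 * V ^ 2) - 16 * u * V / s ^ 4 := by
    rw [hV2, hus]
    exact lowerOrder_eq hs.ne' hs.le hs1 he0 hn hmn
  have hscale' : 16 * u * V / s ^ 4 = 1 * (16 * u * V / s ^ 4) := (one_mul _).symm
  rw [hscale'] at hH ⊢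
  rw [rescale_meanCurvature (E := fun i j => 2 * e / s ^ 5 * P i j)
    (A := fun i j => Chart.cartesian.symbol i j p (jet1 S η p))
    (K := fun i j => k i j - (cartesianChristoffel s u p 0 i j * h 0 +
      cartesianChristoffel s u p 1 i j * h 1))
    (w := fun i j => pd S i (pd S j η) p) (e := e) hs hu0 hV0 one_pos (fun i j => hess i j)
    (Chart.symbol_comm _ _ _ _ _)]
  · rw [Chart.rescaledDefect]
    congr 1
    · refine Finset.sum_congr rfl fun i _ => Finset.sum_congr rfl fun j _ => ?_
      rw [Chart.principal, ← hV2']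
      rfl
    · refine Eq.trans ?_ hlow.symm
      rw [one_mul, ← mul_div_mul_left _ (s ^ 4 * V ^ 2) hu0.ne', ← hcontr']
      field_simp
  · rw [hH]
    congr 2
    ring

/-! ### The covariant Hessian of the height in polar coordinates -/

theorem hasDerivAt_polarProfile {t : ℝ} (ht : 1 - t ^ 2 ≠ 0) :
    HasDerivAt (fun t : ℝ => (1 + t ^ 2) / (1 - t ^ 2)) (4 * t / (1 - t ^ 2) ^ 2) t := by
  refine (((hasDerivAt_pow 2 t).const_add 1).fun_div
    ((hasDerivAt_pow 2 t).const_sub 1) ht).congr_deriv ?_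
  simp
  ring

theorem hasDerivAt_deriv_polarProfile {t : ℝ} (ht : 1 - t ^ 2 ≠ 0) :
    HasDerivAt (fun t : ℝ => 4 * t / (1 - t ^ 2) ^ 2)
      ((4 + 12 * t ^ 2) / (1 - t ^ 2) ^ 3) t := by
  refine (((hasDerivAt_id' t).const_mul 4).fun_div
    (((hasDerivAt_pow 2 t).const_sub 1).fun_pow 2) (pow_ne_zero 2 ht)).congr_deriv ?_
  simp
  field_simp
  ring

/-- Base Christoffel symbols in polar coordinates: those of the metric
`16 dr² / s² + 16 r² u² dθ² / s⁴`, with `s = 1 - r²` and `u = 1 + r²`. -/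
def polarChristoffel (s u r : ℝ) (k i j : Fin 2) : ℝ :=
  ![![![2 * r / s, 0], ![0, -(r * u * (1 + 6 * r ^ 2 + r ^ 4) / s ^ 3)]],
    ![![0, (1 + 6 * r ^ 2 + r ^ 4) / (r * u * s)],
      ![(1 + 6 * r ^ 2 + r ^ 4) / (r * u * s), 0]]] k i j

/-- The covariant derivatives of the coordinate vector fields `a i` of the base map
`(r, θ) ↦ 2r / (1 + r²) · (cos θ, sin θ)` have the coefficients `polarChristoffel` in the frame
`a`; `C` and `S` stand for `cos θ` and `sin θ`. -/
theorem polar_base_hessian {s u r C S : ℝ} (hs : 1 - r ^ 2 = s) (hu : 1 + r ^ 2 = u)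
    (hs0 : s ≠ 0) (hu0 : u ≠ 0) (hr : r ≠ 0) (hCS : C ^ 2 + S ^ 2 = 1)
    {a : Fin 2 → Fin 2 → ℝ} (h00 : a 0 0 = 2 * s / u ^ 2 * C) (h01 : a 0 1 = 2 * s / u ^ 2 * S)
    (h10 : a 1 0 = 2 * r / u * -S) (h11 : a 1 1 = 2 * r / u * C) (i j k : Fin 2) :
    ![![-4 * r * (3 - r ^ 2) / u ^ 3 * ![C, S] k, 2 * s / u ^ 2 * ![-S, C] k],
        ![2 * s / u ^ 2 * ![-S, C] k, 2 * r / u * ![-C, -S] k]] i j +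
      2 / (s ^ 2 / u ^ 2) * ((2 * r / u * C * a i 0 + 2 * r / u * S * a i 1) * a j k +
        (2 * r / u * C * a j 0 + 2 * r / u * S * a j 1) * a i k -
        (a i 0 * a j 0 + a i 1 * a j 1) * (2 * r / u * ![C, S] k)) =
      polarChristoffel s u r 0 i j * a 0 k + polarChristoffel s u r 1 i j * a 1 k := by
  have w0 : 2 * r / u * C * a 0 0 + 2 * r / u * S * a 0 1 = 4 * r * s / u ^ 3 := by
    rw [h00, h01]
    linear_combination 4 * r * s / u ^ 3 * hCS
  have w1 : 2 * r / u * C * a 1 0 + 2 * r / u * S * a 1 1 = 0 := by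
    rw [h10, h11]
    ring
  have e00 : a 0 0 * a 0 0 + a 0 1 * a 0 1 = 4 * s ^ 2 / u ^ 4 := by
    rw [h00, h01]
    linear_combination 4 * s ^ 2 / u ^ 4 * hCS
  have e01 : a 0 0 * a 1 0 + a 0 1 * a 1 1 = 0 := by
    rw [h00, h01, h10, h11]
    ring
  have e10 : a 1 0 * a 0 0 + a 1 1 * a 0 1 = 0 := by
    rw [h00, h01, h10, h11]
    ring
  have e11 : a 1 0 * a 1 0 + a 1 1 * a 1 1 = 4 * r ^ 2 / u ^ 2 := by
    rw [h10, h11]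
    linear_combination 4 * r ^ 2 / u ^ 2 * hCS
  fin_cases i <;> fin_cases j <;> simp only [Fin.zero_eta, Fin.mk_one, w0, w1, e00, e01, e10, e11]
    <;> fin_cases k <;> simp [polarChristoffel, h00, h01, h10, h11] <;> field_simp <;>
    subst hs <;> subst hu <;> ring

/-- The Hessian of `η` for the Euclidean metric `dr² + r² dθ²`, without its second-order part. -/
def polarFlat (r : ℝ) (d : Fin 2 → ℝ) (i j : Fin 2) : ℝ :=
  ![![0, -(d 1 / r)], ![-(d 1 / r), r * d 0]] i j

/-- The remainder of the covariant Hessian of the height `2 e^η u / s`, multiplied by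
`s⁵ / (2 e^η)`: the terms other than the Hessian of `η` for the Euclidean metric. -/
def polarRest (s u r : ℝ) (d : Fin 2 → ℝ) (i j : Fin 2) : ℝ :=
  ![![u * s ^ 4 * d 0 ^ 2 - 4 * u * s ^ 3 * (r * d 0) - 32 * (u + s * (r * d 0)) * r ^ 2 +
      u * (4 * s ^ 2 - 32 * s + 32 + 2 * (s ^ 2 - 4 * s + 8) * s * (r * d 0)),
      u * s ^ 4 * d 0 * d 1 - 2 * u * s ^ 3 * r * d 1],
    ![u * s ^ 4 * d 0 * d 1 - 2 * u * s ^ 3 * r * d 1,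
      u * s ^ 4 * d 1 ^ 2 + r ^ 2 * u * (4 * s ^ 2 - 32 * s + 32 +
        2 * (s ^ 2 - 4 * s + 8) * s * (r * d 0))]] i j

/-- The covariant Hessian of the height `2 e^η u / s`, where `d` and `w` are the first and second
derivatives of `η`. The terms `w + polarFlat` form the Euclidean Hessian of `η`. -/
theorem polar_height_hessian {s u r e : ℝ} (hs : 1 - r ^ 2 = s) (hu : 1 + r ^ 2 = u)
    (hs0 : s ≠ 0) (hu0 : u ≠ 0) (hr : r ≠ 0) (i j : Fin 2) {d h : Fin 2 → ℝ}
    (hh : ∀ i, h i = 2 * e / s ^ 2 * ![u * s * d 0 + 4 * r, u * s * d 1] i) {w : ℝ} :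
    2 * e * (u / s * d i * d j + u / s * w + ![4 * r / s ^ 2, 0] i * d j +
        d i * ![4 * r / s ^ 2, 0] j + ![![(4 + 12 * r ^ 2) / s ^ 3, 0], ![0, 0]] i j) -
      (polarChristoffel s u r 0 i j * h 0 + polarChristoffel s u r 1 i j * h 1) =
    2 * e * u / s * w +
      (2 * e * u / s * polarFlat r d i j + 2 * e / s ^ 5 * polarRest s u r d i j) := by
  simp only [hh]
  fin_cases i <;> fin_cases j <;> simp [polarChristoffel, polarFlat, polarRest] <;> field_simp <;>
    subst hs <;> subst hu <;> ring

/-- The contraction of the remainder with the symbol gives the same function of `|z|²`, `e^η`,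
`z · Dη` and `|Dη|²` as in Cartesian coordinates. -/
theorem polar_contraction {s u e r : ℝ} {d : Fin 2 → ℝ} (hs : 1 - r ^ 2 = s) (hu : 1 + r ^ 2 = u)
    (hr : r ≠ 0) {Y₀ Y₁ : ℝ} (hY₀ : Y₀ = u * s * d 0 + 4 * r) (hY₁ : Y₁ = u * s * d 1) :
    2 * e * ((r * u ^ 2 + e ^ 2 / 4 * Y₁ ^ 2 / r) * polarRest s u r d 0 0 +
      -(e ^ 2 / 4 * (Y₀ * Y₁) / r) * (polarRest s u r d 0 1 + polarRest s u r d 1 0) +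
      (s ^ 2 / r + e ^ 2 / 4 * Y₀ ^ 2 / r) * polarRest s u r d 1 1) =
      r * u * hessNumer s e (r * d 0) (d 0 ^ 2 + d 1 ^ 2 / r ^ 2) := by
  simp only [polarRest, Matrix.cons_val_zero, Matrix.cons_val_one, hessNumer, hY₀, hY₁]
  field_simp
  subst hs hu
  ring

/-! ### The operator in polar coordinates -/

set_option maxHeartbeats 1000000 in
/-- The 2-jet of the immersion in polar coordinates. -/
theorem polar_surface_jets {S : Set (Fin 2 → ℝ)} {p : Fin 2 → ℝ} {η : (Fin 2 → ℝ) → ℝ}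
    (hS : UniqueDiffOn ℝ S) (hp : p ∈ S) (hη : ContDiffOn ℝ 2 η S) {s u e r : ℝ} (hpr : p 0 = r)
    (hs' : 1 - r ^ 2 = s) (hu : 1 + r ^ 2 = u) (hs : 0 < s) (hr : 0 < r)
    (he : Real.exp (η p) = e) {a k : Fin 2 → Fin 2 → ℝ} {d h : Fin 2 → ℝ}
    (hd : ∀ i, pd S i η p = d i)
    (h00 : a 0 0 = 2 * s / u ^ 2 * Real.cos (p 1)) (h01 : a 0 1 = 2 * s / u ^ 2 * Real.sin (p 1))
    (h10 : a 1 0 = 2 * r / u * -Real.sin (p 1)) (h11 : a 1 1 = 2 * r / u * Real.cos (p 1))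
    (hh : ∀ i, h i = 2 * e / s ^ 2 * ![u * s * d 0 + 4 * r, u * s * d 1] i)
    (hk : ∀ i j, k i j = 2 * e * (u / s * d i * d j + u / s * pd S i (pd S j η) p +
      ![4 * r / s ^ 2, 0] i * d j + d i * ![4 * r / s ^ 2, 0] j +
      ![![(4 + 12 * r ^ 2) / s ^ 3, 0], ![0, 0]] i j)) :
    1 - (Chart.polar.surface η p 0 ^ 2 + Chart.polar.surface η p 1 ^ 2) = s ^ 2 / u ^ 2 ∧
    (∀ i, pd S i (Chart.polar.surface η) p = ![a i 0, a i 1, h i]) ∧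
    ∀ i j, covDeriv S (Chart.polar.surface η) i j p =
      ![polarChristoffel s u r 0 i j * a 0 0 + polarChristoffel s u r 1 i j * a 1 0,
        polarChristoffel s u r 0 i j * a 0 1 + polarChristoffel s u r 1 i j * a 1 1, k i j] := by
  have hu0 : 0 < u := by rw [← hu]; positivity
  have hSp := hS p hp
  have hη1 := hη.differentiableOn (by norm_num)
  set X := Chart.polar.surface η with hX
  set f : (Fin 2 → ℝ) → ℝ := fun q => (1 + q 0 ^ 2) / (1 - q 0 ^ 2) with hf
  have hrad : ∀ q, Chart.polar.radiusSq q = q 0 ^ 2 := by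
    intro q
    simp only [Chart.radiusSq, Chart.toPlane, Matrix.cons_val_zero, Matrix.cons_val_one]
    linear_combination q 0 ^ 2 * Real.cos_sq_add_sin_sq (q 1)
  have hsne : ∀ᶠ q in 𝓝[S] p, 1 - q 0 ^ 2 ≠ 0 := by
    have : ContinuousWithinAt (fun q : Fin 2 → ℝ => 1 - q 0 ^ 2) S p :=
      (continuous_const.sub ((continuous_apply 0).pow 2)).continuousWithinAt
    exact this.eventually_ne (by simp only [hpr, hs']; exact hs.ne')
  have hfd : ∀ᶠ q in 𝓝[S] p, DifferentiableWithinAt ℝ f S q := by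
    filter_upwards [hsne] with q hq
    fun_prop (disch := assumption)
  have hfj : ∀ j, ∀ᶠ q in 𝓝[S] p,
      pd S j f q = if j = 0 then 4 * q 0 / (1 - q 0 ^ 2) ^ 2 else 0 := by
    intro j
    filter_upwards [hsne, self_mem_nhdsWithin] with q hq hqS
    exact pd_comp_coord (φ := fun t => (1 + t ^ 2) / (1 - t ^ 2)) (hS q hqS)
      (hasDerivAt_polarProfile hq)
  have hsp : 1 - p 0 ^ 2 ≠ 0 := hsne.self_of_nhdsWithin hp
  have hsp2 := pow_ne_zero 2 hsp
  have hfj' : ∀ j : Fin 2, DifferentiableWithinAt ℝ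
      (fun q : Fin 2 → ℝ => if j = 0 then 4 * q 0 / (1 - q 0 ^ 2) ^ 2 else 0) S p := by
    intro j
    split_ifs <;> fun_prop (disch := assumption)
  have hfij : ∀ i j : Fin 2, pd S i (fun q => if j = 0 then 4 * q 0 / (1 - q 0 ^ 2) ^ 2 else 0) p =
      ![![(4 + 12 * r ^ 2) / s ^ 3, 0], ![0, 0]] i j := by
    intro i j
    have := pd_comp_coord (i := i) (φ := fun t => 4 * t / (1 - t ^ 2) ^ 2) hSp
      (hasDerivAt_deriv_polarProfile hsp)
    rw [hpr, hs'] at this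
    fin_cases j
    · refine this.trans ?_
      fin_cases i <;> simp
    · refine (pd_const 0).trans ?_
      fin_cases i <;> simp
  have hX0 : (fun q => X q 0) = fun q => 2 * q 0 / (1 + q 0 ^ 2) * Real.cos (q 1) := by
    funext q
    change 2 / (1 + Chart.polar.radiusSq q) * (q 0 * Real.cos (q 1)) = _
    rw [hrad]
    ring
  have hX1 : (fun q => X q 1) = fun q => 2 * q 0 / (1 + q 0 ^ 2) * Real.sin (q 1) := by
    funext q
    change 2 / (1 + Chart.polar.radiusSq q) * (q 0 * Real.sin (q 1)) = _
    rw [hrad]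
    ring
  have hX2 : (fun q => X q 2) = fun q => 2 * Real.exp (η q) * f q := by
    funext q
    change 2 * Real.exp (η q) * ((1 + Chart.polar.radiusSq q) / (1 - Chart.polar.radiusSq q)) = _
    rw [hrad]
  -- the base components are products of functions of `r` and of `θ`
  have hcos : ∀ t, HasDerivAt (fun t => -Real.sin t) (-Real.cos t) t :=
    fun t => (Real.hasDerivAt_sin t).neg
  have b0 := fun i j => pd_pd_polar_mul (i := i) (j := j) hS hp
    (fun t => hasDerivAt_two_mul_div (t := t)) Real.hasDerivAt_cos
    (fun t => hasDerivAt_two_mul_sub_div_sq (t := t)) hcos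
  have b1 := fun i j => pd_pd_polar_mul (i := i) (j := j) hS hp
    (fun t => hasDerivAt_two_mul_div (t := t)) Real.hasDerivAt_sin
    (fun t => hasDerivAt_two_mul_sub_div_sq (t := t)) Real.hasDerivAt_cos
  have hXd : ∀ᶠ q in 𝓝[S] p, ∀ k, DifferentiableWithinAt ℝ (fun q => X q k) S q := by
    filter_upwards [hfd, self_mem_nhdsWithin] with q hq hqS k
    have hηq := hη1 q hqS
    have : 1 + q 0 ^ 2 ≠ 0 := by positivity
    fin_cases k
    · simp only [Fin.zero_eta, hX0]
      fun_prop (disch := assumption)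
    · simp only [Fin.mk_one, hX1]
      fun_prop (disch := assumption)
    · simp only [Fin.reduceFinMk, hX2]
      fun_prop
  have hXdd : ∀ j k, DifferentiableWithinAt ℝ (pd S j (fun q => X q k)) S p := by
    intro j k
    fin_cases k
    · simp only [Fin.zero_eta, hX0]
      exact (b0 j j).1
    · simp only [Fin.mk_one, hX1]
      exact (b1 j j).1
    · simp only [Fin.reduceFinMk, hX2]
      exact differentiableWithinAt_pd_height hS hη hp hfd (hfj j) (hfj' j)
  have hpdX : ∀ i, pd S i X p = ![a i 0, a i 1, h i] := by
    intro i
    have hap := pd_apply (i := i) hSp (hXd.self_of_nhdsWithin hp)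
    funext k
    fin_cases k
    · refine (hap 0).trans ?_
      rw [hX0, pd_polar_mul hSp (fun t => hasDerivAt_two_mul_div (t := t)) Real.hasDerivAt_cos, hpr,
        hs', hu]
      fin_cases i
      · exact h00.symm
      · exact h10.symm
    · refine (hap 1).trans ?_
      rw [hX1, pd_polar_mul hSp (fun t => hasDerivAt_two_mul_div (t := t)) Real.hasDerivAt_sin, hpr,
        hs', hu]
      fin_cases i
      · exact h01.symm
      · exact h11.symm
    · refine (hap 2).trans ?_
      rw [hX2, pd_height hSp (hη1 p hp) (hfd.self_of_nhdsWithin hp),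
        (hfj i).self_of_nhdsWithin hp]
      refine Eq.trans ?_ (hh i).symm
      simp only [hf, hpr, hu, hs', hd, he]
      fin_cases i <;> simp <;> field_simp
  have hXp0 : X p 0 = 2 * r / u * Real.cos (p 1) := by
    rw [← hu, ← hpr]
    exact congrFun hX0 p
  have hXp1 : X p 1 = 2 * r / u * Real.sin (p 1) := by
    rw [← hu, ← hpr]
    exact congrFun hX1 p
  have hD : 1 - (X p 0 ^ 2 + X p 1 ^ 2) = s ^ 2 / u ^ 2 := by
    have : X p 0 ^ 2 + X p 1 ^ 2 = (2 * r / u) ^ 2 := by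
      rw [hXp0, hXp1]
      linear_combination (2 * r / u) ^ 2 * Real.cos_sq_add_sin_sq (p 1)
    rw [this]
    field_simp
    rw [← hs', ← hu]
    ring
  have hD0 : s ^ 2 / u ^ 2 ≠ 0 := by positivity
  refine ⟨hD, hpdX, fun i j => ?_⟩
  have hpp := pd_pd_apply (i := i) (j := j) hS hp hXd (hXdd j)
  have hbase := polar_base_hessian hs' hu hs.ne' hu0.ne' hr.ne'
    (Real.cos_sq_add_sin_sq (p 1)) h00 h01 h10 h11 i j
  funext l
  rw [covDeriv, sum_christoffel _ (hD ▸ hD0), hD, hpp, hpdX, hpdX, hXp0, hXp1]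
  fin_cases l
  · refine Eq.trans ?_ (hbase 0)
    simp only [Fin.zero_eta, hX0, (b0 i j).2, hpr, hs', hu]
    rfl
  · refine Eq.trans ?_ (hbase 1)
    simp only [Fin.mk_one, hX1, (b1 i j).2, hpr, hs', hu]
    rfl
  · refine Eq.trans ?_ (hk i j).symm
    simp only [Fin.reduceFinMk, hX2]
    rw [pd_pd_height hS hη hp hfd (hfj j) (hfj' j), (hfj i).self_of_nhdsWithin hp, hfij]
    simp only [hf, hpr, hu, hs', hd, he]
    refine (add_zero _).trans ?_
    fin_cases i <;> fin_cases j <;> simp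

/-- In polar coordinates, `√|g| = 16 r (1 + r²) V / (1 - r²)⁴` with `V` the slope, and
`√|g| (2H - 1)` is the function `rescaledDefect` of the 2-jet. -/
theorem polar_operator {S : Set (Fin 2 → ℝ)} {p : Fin 2 → ℝ} {η : (Fin 2 → ℝ) → ℝ}
    (hS : UniqueDiffOn ℝ S) (hp : p ∈ S) (hr : 0 < p 0) (hs : 0 < Chart.polar.defect p)
    (hη : ContDiffOn ℝ 2 η S) :
    (inducedMetric S (Chart.polar.surface η) p).det =
      (p 0 * (16 * (2 - Chart.polar.defect p) * Chart.polar.slope p (jet1 S η p) /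
        Chart.polar.defect p ^ 4)) ^ 2 ∧
    p 0 * (16 * (2 - Chart.polar.defect p) * Chart.polar.slope p (jet1 S η p) /
        Chart.polar.defect p ^ 4) *
        (2 * meanCurvature S (Chart.polar.surface η) p - 1) =
      Chart.polar.rescaledDefect p (jet2 S η p) := by
  set s := Chart.polar.defect p with hs_def
  obtain ⟨r, hpr⟩ : ∃ r, p 0 = r := ⟨_, rfl⟩
  rw [hpr] at hr
  have hs' : 1 - r ^ 2 = s := by rw [← hpr]; rfl
  obtain ⟨u, hu⟩ : ∃ u, 1 + r ^ 2 = u := ⟨_, rfl⟩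
  have hus : u = 2 - s := by linarith
  have hu0 : 0 < u := by rw [← hu]; positivity
  have hs1 : s ≤ 1 := by nlinarith [sq_nonneg r]
  set d : Fin 2 → ℝ := fun i => pd S i η p with hd
  set e := Real.exp (η p) with he
  have he0 : 0 < e := Real.exp_pos _
  have hn : 0 ≤ d 0 ^ 2 + d 1 ^ 2 / r ^ 2 := by positivity
  have hmn : (r * d 0) ^ 2 ≤ (1 - s) * (d 0 ^ 2 + d 1 ^ 2 / r ^ 2) := by
    rw [← hs']
    have : (1 - (1 - r ^ 2)) * (d 0 ^ 2 + d 1 ^ 2 / r ^ 2) = (r * d 0) ^ 2 + d 1 ^ 2 := by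
      field_simp
      ring
    rw [this]
    nlinarith [sq_nonneg (d 1)]
  set V := Chart.polar.slope p (jet1 S η p) with hV
  have hVr : V = H2R.slope s e (r * d 0) (d 0 ^ 2 + d 1 ^ 2 / r ^ 2) := by rw [← hpr]; rfl
  have hV0 : 0 < V := hVr ▸ slope_pos hs.le hs1 he0 hn hmn
  have hV2 : V ^ 2 = H2R.slopeSq s e (r * d 0) (d 0 ^ 2 + d 1 ^ 2 / r ^ 2) := by
    rw [hVr]
    exact Real.sq_sqrt (slopeSq_pos hs.le hs1 he0 hn hmn).le
  have hV2' : Chart.polar.slopeSq p (jet1 S η p) = V ^ 2 := by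
    rw [hV2, ← hpr]
    rfl
  obtain ⟨h, hh⟩ : ∃ h : Fin 2 → ℝ,
      ∀ i, h i = 2 * e / s ^ 2 * ![u * s * d 0 + 4 * r, u * s * d 1] i := ⟨_, fun _ => rfl⟩
  obtain ⟨a, ha⟩ : ∃ a : Fin 2 → Fin 2 → ℝ, a =
      ![![2 * s / u ^ 2 * Real.cos (p 1), 2 * s / u ^ 2 * Real.sin (p 1)],
        ![2 * r / u * -Real.sin (p 1), 2 * r / u * Real.cos (p 1)]] := ⟨_, rfl⟩
  have h00 : a 0 0 = 2 * s / u ^ 2 * Real.cos (p 1) := by rw [ha]; rfl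
  have h01 : a 0 1 = 2 * s / u ^ 2 * Real.sin (p 1) := by rw [ha]; rfl
  have h10 : a 1 0 = 2 * r / u * -Real.sin (p 1) := by rw [ha]; rfl
  have h11 : a 1 1 = 2 * r / u * Real.cos (p 1) := by rw [ha]; rfl
  obtain ⟨k, hk⟩ : ∃ k : Fin 2 → Fin 2 → ℝ, ∀ i j, k i j = 2 * e * (u / s * d i * d j +
      u / s * pd S i (pd S j η) p + ![4 * r / s ^ 2, 0] i * d j + d i * ![4 * r / s ^ 2, 0] j +
      ![![(4 + 12 * r ^ 2) / s ^ 3, 0], ![0, 0]] i j) := ⟨_, fun _ _ => rfl⟩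
  obtain ⟨hD, hpdX, hcov⟩ := polar_surface_jets hS hp hη hpr hs' hu hs hr rfl (fun _ => rfl)
    h00 h01 h10 h11 hh hk
  have hD0 : s ^ 2 / u ^ 2 ≠ 0 := by positivity
  have hCS := Real.cos_sq_add_sin_sq (p 1)
  have hh0 : h 0 = 2 * e / s ^ 2 * (u * s * d 0 + 4 * r) := hh 0
  have hh1 : h 1 = 2 * e / s ^ 2 * (u * s * d 1) := hh 1
  have hJ : a 0 0 * a 1 1 - a 0 1 * a 1 0 = 4 * r * s / u ^ 3 := by
    rw [h00, h01, h10, h11]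
    linear_combination 4 * r * s / u ^ 3 * hCS
  have hW : (s ^ 2 / u ^ 2) ^ 2 / 4 * ((a 0 1 * h 1 - h 0 * a 1 1) ^ 2 +
      (h 0 * a 1 0 - a 0 0 * h 1) ^ 2) + (4 * r * s / u ^ 3) ^ 2 =
      (4 * r * s / u ^ 3 * (V / s)) ^ 2 := by
    have e1 : (4 * r * s / u ^ 3 * (V / s)) ^ 2 = 16 * r ^ 2 / u ^ 6 * V ^ 2 := by
      field_simp
      ring
    have e2 : (a 0 1 * h 1 - h 0 * a 1 1) ^ 2 + (h 0 * a 1 0 - a 0 0 * h 1) ^ 2 =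
        (2 * s / u ^ 2 * h 1) ^ 2 + (2 * r / u * h 0) ^ 2 := by
      rw [h00, h01, h10, h11]
      linear_combination ((2 * s / u ^ 2 * h 1) ^ 2 + (2 * r / u * h 0) ^ 2) * hCS
    rw [e1, e2, hV2, H2R.slopeSq, hh0, hh1]
    field_simp
    rw [← hs', ← hu]
    ring
  obtain ⟨hdet, hH⟩ := meanCurvature_graph hD hD0 (by positivity) (div_pos hV0 hs) hpdX hcov hJ hW
  have hscale : 4 / (s ^ 2 / u ^ 2) ^ 2 * (4 * r * s / u ^ 3) * (V / s) =
      r * (16 * u * V / s ^ 4) := by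
    field_simp
    ring
  rw [hscale] at hdet hH
  rw [← hus, hpr]
  refine ⟨hdet, ?_⟩
  have hA : ∀ i j, Chart.polar.symbol i j p (jet1 S η p) =
      ![![r * u ^ 2 + e ^ 2 / 4 * (u * s * d 1) ^ 2 / r,
        -(e ^ 2 / 4 * ((u * s * d 0 + 4 * r) * (u * s * d 1)) / r)],
      ![-(e ^ 2 / 4 * ((u * s * d 0 + 4 * r) * (u * s * d 1)) / r),
        s ^ 2 / r + e ^ 2 / 4 * (u * s * d 0 + 4 * r) ^ 2 / r]] i j := by
    intro i j
    simp only [Chart.symbol, jet1, hpr, hs', hu]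
    rfl
  -- the matrix of the induced metric is the adjugate of the symbol, up to scaling
  have g11 : 4 / (s ^ 2 / u ^ 2) ^ 2 * (a 1 0 ^ 2 + a 1 1 ^ 2) + h 1 ^ 2 =
      r * (16 / s ^ 4 * Chart.polar.symbol 0 0 p (jet1 S η p)) := by
    have : a 1 0 ^ 2 + a 1 1 ^ 2 = (2 * r / u) ^ 2 := by
      rw [h10, h11]
      linear_combination (2 * r / u) ^ 2 * hCS
    rw [this, hh1, hA]
    simp only [Matrix.cons_val_zero]
    field_simp
    ring
  have g01 : 4 / (s ^ 2 / u ^ 2) ^ 2 * (a 0 0 * a 1 0 + a 0 1 * a 1 1) + h 0 * h 1 =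
      -(r * (16 / s ^ 4 * Chart.polar.symbol 0 1 p (jet1 S η p))) := by
    have : a 0 0 * a 1 0 + a 0 1 * a 1 1 = 0 := by
      rw [h00, h01, h10, h11]
      ring
    rw [this, hh0, hh1, hA]
    simp only [Matrix.cons_val_zero, Matrix.cons_val_one]
    field_simp
    ring
  have g00 : 4 / (s ^ 2 / u ^ 2) ^ 2 * (a 0 0 ^ 2 + a 0 1 ^ 2) + h 0 ^ 2 =
      r * (16 / s ^ 4 * Chart.polar.symbol 1 1 p (jet1 S η p)) := by
    have : a 0 0 ^ 2 + a 0 1 ^ 2 = (2 * s / u ^ 2) ^ 2 := by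
      rw [h00, h01]
      linear_combination (2 * s / u ^ 2) ^ 2 * hCS
    rw [this, hh0, hA]
    simp only [Matrix.cons_val_one, Matrix.cons_val_fin_one]
    field_simp
    ring
  rw [g11, g01, g00] at hH
  have hess := fun i j => polar_height_hessian hs' hu hs.ne' hu0.ne' hr.ne' i j hh
    (w := pd S i (pd S j η) p) (d := d) (e := e)
  simp only [← hk] at hess
  have hcontr : 2 * e * (Chart.polar.symbol 0 0 p (jet1 S η p) * polarRest s u r d 0 0 +
      Chart.polar.symbol 0 1 p (jet1 S η p) * (polarRest s u r d 0 1 + polarRest s u r d 1 0) +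
      Chart.polar.symbol 1 1 p (jet1 S η p) * polarRest s u r d 1 1) =
      r * u * hessNumer s e (r * d 0) (d 0 ^ 2 + d 1 ^ 2 / r ^ 2) := by
    rw [← polar_contraction hs' hu hr.ne' rfl rfl, hA, hA, hA]
    rfl
  have hlow : Chart.polar.lower p (jet1 S η p) =
      r * (hessNumer s e (r * d 0) (d 0 ^ 2 + d 1 ^ 2 / r ^ 2) / (s ^ 4 * V ^ 2) -
        16 * u * V / s ^ 4) -
      2 * (2 * e * Chart.polar.symbol 0 1 p (jet1 S η p) / V ^ 2) * d 1 / r +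
      2 * e * Chart.polar.symbol 1 1 p (jet1 S η p) / V ^ 2 * (r * d 0) := by
    have := lowerOrder_eq hs.ne' hs.le hs1 he0 hn hmn
    rw [← hVr, ← hus, ← hV2] at this
    rw [← this, ← hV2', ← hpr]
    rfl
  rw [rescale_meanCurvature
    (E := fun i j => 2 * e * u / s * polarFlat r d i j + 2 * e / s ^ 5 * polarRest s u r d i j)
    (A := fun i j => Chart.polar.symbol i j p (jet1 S η p))
    (K := fun i j => k i j - (polarChristoffel s u r 0 i j * h 0 +
      polarChristoffel s u r 1 i j * h 1))
    (w := fun i j => pd S i (pd S j η) p) (e := e) hs hu0 hV0 hr (fun i j => hess i j)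
    (Chart.symbol_comm _ _ _ _ _)]
  · rw [Chart.rescaledDefect]
    congr 1
    · refine Finset.sum_congr rfl fun i _ => Finset.sum_congr rfl fun j _ => ?_
      rw [Chart.principal, ← hV2']
      rfl
    · refine Eq.trans ?_ hlow.symm
      have hN : r * (hessNumer s e (r * d 0) (d 0 ^ 2 + d 1 ^ 2 / r ^ 2) / (s ^ 4 * V ^ 2)) =
          r * u * hessNumer s e (r * d 0) (d 0 ^ 2 + d 1 ^ 2 / r ^ 2) / (u * (s ^ 4 * V ^ 2)) := by
        rw [mul_right_comm, mul_comm _ u, mul_div_mul_left _ _ hu0.ne', mul_div_assoc]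
      rw [mul_sub, hN, ← hcontr]
      simp only [polarFlat, Matrix.cons_val_zero, Matrix.cons_val_one]
      field_simp
      ring
  · rw [hH]
    congr 2
    ring

/-! ### Admissible domains -/

theorem convex_disk (c : Fin 2 → ℝ) (ρ : ℝ) :
    Convex ℝ {p : Fin 2 → ℝ | (p 0 - c 0) ^ 2 + (p 1 - c 1) ^ 2 ≤ ρ ^ 2} := by
  have h : ∀ i, ConvexOn ℝ Set.univ fun p : Fin 2 → ℝ => (p i - c i) ^ 2 := by
    intro i
    have := (Even.convexOn_pow (𝕜 := ℝ) (even_two)).comp_affineMap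
      ((LinearMap.proj i : (Fin 2 → ℝ) →ₗ[ℝ] ℝ).toAffineMap - AffineMap.const ℝ _ (c i))
    simpa [Function.comp_def] using this
  simpa using ((h 0).add (h 1)).convex_le (ρ ^ 2)

theorem uniqueDiffWithinAt_disk {c p : Fin 2 → ℝ} {ρ : ℝ} (hρ : 0 < ρ)
    (hp : (p 0 - c 0) ^ 2 + (p 1 - c 1) ^ 2 ≤ ρ ^ 2) :
    UniqueDiffWithinAt ℝ {p : Fin 2 → ℝ | (p 0 - c 0) ^ 2 + (p 1 - c 1) ^ 2 ≤ ρ ^ 2} p := by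
  refine uniqueDiffWithinAt_convex (convex_disk c ρ) ⟨c, ?_⟩ (subset_closure hp)
  have ho : IsOpen {p : Fin 2 → ℝ | (p 0 - c 0) ^ 2 + (p 1 - c 1) ^ 2 < ρ ^ 2} :=
    isOpen_lt (by fun_prop) (by fun_prop)
  have hsub : {p : Fin 2 → ℝ | (p 0 - c 0) ^ 2 + (p 1 - c 1) ^ 2 < ρ ^ 2} ⊆
      {p : Fin 2 → ℝ | (p 0 - c 0) ^ 2 + (p 1 - c 1) ^ 2 ≤ ρ ^ 2} :=
    Set.ofPred_subset_ofPred.2 fun _ hq => hq.le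
  refine interior_maximal hsub ho ?_
  simp
  positivity

theorem Chart.uniqueDiffOn_closedDomain (c : Chart) {R : ℝ} (hR : R ∈ c.radii) :
    UniqueDiffOn ℝ (c.closedDomain R) := by
  cases c with
  | polar =>
    obtain ⟨-, hR1⟩ := hR
    have : Chart.polar.closedDomain R =
        (fun p : Fin 2 → ℝ => p 0) ⁻¹' Set.Icc R 1 := by
      ext p
      rfl
    rw [this]
    refine uniqueDiffOn_convex ?_ ?_
    · exact (convex_Icc R 1).is_linear_preimage ⟨fun _ _ => rfl, fun _ _ => rfl⟩
    · refine ⟨fun _ => (R + 1) / 2, ?_⟩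
      refine interior_maximal (t := (fun p : Fin 2 → ℝ => p 0) ⁻¹' Set.Ioo R 1)
        (Set.preimage_mono Set.Ioo_subset_Icc_self)
        (isOpen_Ioo.preimage (continuous_apply 0)) ?_
      constructor <;> simp <;> linarith
  | cartesian =>
    obtain ⟨hR0, hR1⟩ := hR
    rintro p ⟨hp1, hp2⟩
    rcases hR0.eq_or_lt with rfl | hR0
    · refine (uniqueDiffWithinAt_disk (c := 0) one_pos (p := p) (by simpa using hp2)).mono ?_
      intro q hq
      have hq' : q 0 ^ 2 + q 1 ^ 2 ≤ 1 := by simpa using hq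
      exact ⟨by rw [zero_pow two_ne_zero]; positivity, hq'⟩
    -- `p` lies in a disk inside the annulus, centred on the ray through `p` at distance
    -- `(R + 1) / 2` from the origin
    · set t := √(p 0 ^ 2 + p 1 ^ 2) with ht
      have htsq : t ^ 2 = p 0 ^ 2 + p 1 ^ 2 := Real.sq_sqrt (by positivity)
      have ht0 : 0 ≤ t := Real.sqrt_nonneg _
      have htR : R ≤ t := by nlinarith
      have ht1 : t ≤ 1 := by nlinarith
      have htp : 0 < t := by linarith
      set l := (R + 1) / 2 / t with hl
      have hlt : l * t = (R + 1) / 2 := by rw [hl]; field_simp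
      refine (uniqueDiffWithinAt_disk (c := l • p) (ρ := (1 - R) / 2) (by linarith) (p := p)
        ?_).mono ?_
      · have : (p 0 - (l • p) 0) ^ 2 + (p 1 - (l • p) 1) ^ 2 = (t - l * t) ^ 2 := by
          simp only [Pi.smul_apply, smul_eq_mul]
          linear_combination -(1 - l) ^ 2 * htsq
        rw [this, hlt]
        nlinarith
      · intro q hq
        set n := √(q 0 ^ 2 + q 1 ^ 2) with hn
        have hnsq : n ^ 2 = q 0 ^ 2 + q 1 ^ 2 := Real.sq_sqrt (by positivity)
        have hn0 : 0 ≤ n := Real.sqrt_nonneg _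
        have hq' : (q 0 - (l • p) 0) ^ 2 + (q 1 - (l • p) 1) ^ 2 ≤ ((1 - R) / 2) ^ 2 := hq
        have hcs : q 0 * p 0 + q 1 * p 1 ≤ n * t := by
          refine le_of_sq_le_sq ?_ (by positivity)
          rw [mul_pow, hnsq, htsq]
          nlinarith [sq_nonneg (q 0 * p 1 - q 1 * p 0)]
        have hl0 : 0 ≤ l := by positivity
        have h1 : (n - (R + 1) / 2) ^ 2 ≤ ((1 - R) / 2) ^ 2 := by
          refine le_trans ?_ hq'
          rw [← hlt]
          simp only [Pi.smul_apply, smul_eq_mul]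
          have := mul_le_mul_of_nonneg_left hcs hl0
          have hexp : (q 0 - l * p 0) ^ 2 + (q 1 - l * p 1) ^ 2 =
              n ^ 2 - 2 * (l * (q 0 * p 0 + q 1 * p 1)) + (l * t) ^ 2 := by
            linear_combination -hnsq - l ^ 2 * htsq
          rw [hexp]
          linarith
        obtain ⟨h2, h3⟩ := abs_le_of_sq_le_sq' h1 (by linarith)
        constructor
        · rw [← hnsq]
          exact pow_le_pow_left₀ hR0.le (by linarith) 2
        · rw [← hnsq]
          exact pow_le_one₀ hn0 (by linarith)

/-! ### The operator on the admissible domains -/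

/-- The inequalities that make the slope positive; the last one is the Cauchy-Schwarz inequality
for `z · Dη`. -/
theorem Chart.jet_bounds (c : Chart) {R : ℝ} (hR : R ∈ c.radii) {x : Fin 2 → ℝ}
    (hx : x ∈ c.closedDomain R) (d : Fin 2 → ℝ) :
    0 < c.jacobian x ∧ 0 ≤ c.defect x ∧ c.defect x ≤ 1 ∧ 0 ≤ c.gradSq x d ∧
      c.radial x d ^ 2 ≤ (1 - c.defect x) * c.gradSq x d := by
  cases c with
  | polar =>
    obtain ⟨hR0, hR1⟩ := hR
    obtain ⟨h1, h2⟩ := hx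
    have hx0 : 0 < x 0 := hR0.trans_le h1
    refine ⟨hx0, ?_, ?_, ?_, ?_⟩
    · change 0 ≤ 1 - x 0 ^ 2
      nlinarith
    · change 1 - x 0 ^ 2 ≤ 1
      nlinarith
    · change 0 ≤ d 0 ^ 2 + d 1 ^ 2 / x 0 ^ 2
      positivity
    · change (x 0 * d 0) ^ 2 ≤ (1 - (1 - x 0 ^ 2)) * (d 0 ^ 2 + d 1 ^ 2 / x 0 ^ 2)
      have : (1 - (1 - x 0 ^ 2)) * (d 0 ^ 2 + d 1 ^ 2 / x 0 ^ 2) = (x 0 * d 0) ^ 2 + d 1 ^ 2 := by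
        field_simp
        ring
      rw [this]
      nlinarith [sq_nonneg (d 1)]
  | cartesian =>
    obtain ⟨-, h2⟩ := hx
    refine ⟨one_pos, ?_, ?_, ?_, ?_⟩
    · change 0 ≤ 1 - (x 0 ^ 2 + x 1 ^ 2)
      linarith
    · change 1 - (x 0 ^ 2 + x 1 ^ 2) ≤ 1
      nlinarith [sq_nonneg (x 0), sq_nonneg (x 1)]
    · change 0 ≤ d 0 ^ 2 + d 1 ^ 2
      positivity
    · change (x 0 * d 0 + x 1 * d 1) ^ 2 ≤ (1 - (1 - (x 0 ^ 2 + x 1 ^ 2))) * (d 0 ^ 2 + d 1 ^ 2)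
      nlinarith [sq_nonneg (x 0 * d 1 - x 1 * d 0)]

theorem Chart.slopeSq_pos (c : Chart) {R : ℝ} (hR : R ∈ c.radii) {x : Fin 2 → ℝ}
    (hx : x ∈ c.closedDomain R) (J : Jet1) : 0 < c.slopeSq x J := by
  obtain ⟨-, h0, h1, h2, h3⟩ := c.jet_bounds hR hx J.2
  exact H2R.slopeSq_pos h0 h1 (Real.exp_pos _) h2 h3

theorem Chart.slope_pos (c : Chart) {R : ℝ} (hR : R ∈ c.radii) {x : Fin 2 → ℝ}
    (hx : x ∈ c.closedDomain R) (J : Jet1) : 0 < c.slope x J :=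
  Real.sqrt_pos.2 (c.slopeSq_pos hR hx J)

theorem Chart.operator (c : Chart) {R : ℝ} (hR : R ∈ c.radii) {p : Fin 2 → ℝ}
    (hp : p ∈ c.domain R) {η : (Fin 2 → ℝ) → ℝ} (hη : ContDiffOn ℝ 2 η (c.closedDomain R)) :
    c.detMetric R η p = (c.jacobian p * (16 * (2 - c.defect p) *
      c.slope p (jet1 (c.closedDomain R) η p) / c.defect p ^ 4)) ^ 2 ∧
    c.jacobian p * (16 * (2 - c.defect p) * c.slope p (jet1 (c.closedDomain R) η p) /
      c.defect p ^ 4) * (2 * c.H R η p - 1) =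
      c.rescaledDefect p (jet2 (c.closedDomain R) η p) := by
  have hS := c.uniqueDiffOn_closedDomain hR
  cases c with
  | polar =>
    obtain ⟨h1, h2⟩ := hp
    have hr : 0 < p 0 := hR.1.trans_le h1
    refine polar_operator hS ⟨h1, h2.le⟩ hr ?_ hη
    change 0 < 1 - p 0 ^ 2
    nlinarith
  | cartesian =>
    obtain ⟨h1, h2⟩ := hp
    have := cartesian_operator hS ⟨h1, h2.le⟩ (sub_pos.2 h2) hη
    simp only [Chart.jacobian, one_mul]
    exact this

/-! ### Ellipticity -/

/-- The symbol does not degenerate at `|z| = 1`, since the slope is positive there. -/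
theorem Chart.symbol_det (c : Chart) {R : ℝ} (hR : R ∈ c.radii) {x : Fin 2 → ℝ}
    (hx : x ∈ c.closedDomain R) (J : Jet1) :
    c.symbol 0 0 x J * c.symbol 1 1 x J - c.symbol 0 1 x J ^ 2 =
      (2 - c.defect x) ^ 2 * c.slopeSq x J := by
  have hj := (c.jet_bounds hR hx J.2).1
  cases c with
  | polar =>
    have hx0 : 0 < x 0 := hj
    simp only [Chart.symbol, Chart.slopeSq, H2R.slopeSq, Chart.defect, Chart.radial, Chart.gradSq]
    simp
    field_simp
    ring
  | cartesian =>
    simp only [Chart.symbol, Chart.slopeSq, H2R.slopeSq, Chart.defect, Chart.radial, Chart.gradSq]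
    simp
    ring

theorem Chart.symbol_diag_nonneg (c : Chart) {R : ℝ} (hR : R ∈ c.radii) {x : Fin 2 → ℝ}
    (hx : x ∈ c.closedDomain R) (J : Jet1) : 0 ≤ c.symbol 0 0 x J ∧ 0 ≤ c.symbol 1 1 x J := by
  have hj := (c.jet_bounds hR hx J.2).1
  cases c with
  | polar =>
    have hx0 : 0 < x 0 := hj
    simp only [Chart.symbol]
    simp
    constructor <;> positivity
  | cartesian =>
    simp only [Chart.symbol]
    simp
    constructor <;> positivity

theorem Chart.principal_pos (c : Chart) {R : ℝ} (hR : R ∈ c.radii) {x : Fin 2 → ℝ}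
    (hx : x ∈ c.closedDomain R) (J : Jet1) :
    0 < c.principal 0 0 x J * c.principal 1 1 x J - c.principal 0 1 x J ^ 2 ∧
      0 < c.principal 0 0 x J + c.principal 1 1 x J := by
  have hQ := c.slopeSq_pos hR hx J
  have h1 := (c.jet_bounds hR hx J.2).2.2.1
  have hdet : 0 < c.symbol 0 0 x J * c.symbol 1 1 x J - c.symbol 0 1 x J ^ 2 := by
    rw [c.symbol_det hR hx]
    have : 0 < 2 - c.defect x := by linarith
    positivity
  obtain ⟨h00, h11⟩ := c.symbol_diag_nonneg hR hx J
  have htr : 0 < c.symbol 0 0 x J + c.symbol 1 1 x J := by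
    by_contra! h
    have : c.symbol 0 0 x J = 0 := by linarith
    rw [this] at hdet
    nlinarith [sq_nonneg (c.symbol 0 1 x J)]
  have he : 0 < 2 * Real.exp J.1 / c.slopeSq x J := by positivity
  have hp : ∀ i j, c.principal i j x J = 2 * Real.exp J.1 / c.slopeSq x J * c.symbol i j x J := by
    intro i j
    rw [Chart.principal]
    ring
  rw [hp, hp, hp]
  constructor
  · have := mul_pos (pow_pos he 2) hdet
    linarith
  · rw [← mul_add]
    exact mul_pos he htr

/-- A symmetric matrix with positive trace is bounded below by the quotient of its determinant and
its trace, by the Cayley-Hamilton theorem. -/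
theorem det_div_trace_mul_le {a b d x y : ℝ} (h : 0 < a + d) :
    (a * d - b ^ 2) / (a + d) * (x ^ 2 + y ^ 2) ≤
      a * x * x + b * x * y + (b * y * x + d * y * y) := by
  rw [div_mul_eq_mul_div, div_le_iff₀ h]
  nlinarith [sq_nonneg (a * x + b * y), sq_nonneg (b * x + d * y)]

/-! ### Analyticity -/

section Analytic

variable {Y : Type*} [NormedAddCommGroup Y] [NormedSpace ℝ Y] {y₀ : Y}

theorem analyticAt_slopeSq {s e m n : Y → ℝ} (hs : AnalyticAt ℝ s y₀) (he : AnalyticAt ℝ e y₀)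
    (hm : AnalyticAt ℝ m y₀) (hn : AnalyticAt ℝ n y₀) :
    AnalyticAt ℝ (fun y => slopeSq (s y) (e y) (m y) (n y)) y₀ := by
  unfold slopeSq
  simp only [div_eq_mul_inv]
  fun_prop

theorem analyticAt_slope {s e m n : Y → ℝ} (hs : AnalyticAt ℝ s y₀) (he : AnalyticAt ℝ e y₀)
    (hm : AnalyticAt ℝ m y₀) (hn : AnalyticAt ℝ n y₀)
    (h : 0 < slopeSq (s y₀) (e y₀) (m y₀) (n y₀)) :
    AnalyticAt ℝ (fun y => slope (s y) (e y) (m y) (n y)) y₀ :=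
  AnalyticAt.comp (f := fun y => slopeSq (s y) (e y) (m y) (n y))
    (Real.contDiffAt_sqrt h.ne').analyticAt (analyticAt_slopeSq hs he hm hn)

theorem analyticAt_lowerOrder {s e m n : Y → ℝ} (hs : AnalyticAt ℝ s y₀) (he : AnalyticAt ℝ e y₀)
    (hm : AnalyticAt ℝ m y₀) (hn : AnalyticAt ℝ n y₀) (hs0 : 0 ≤ s y₀) (hs1 : s y₀ ≤ 1)
    (he0 : 0 < e y₀) (hn0 : 0 ≤ n y₀) (hmn : m y₀ ^ 2 ≤ (1 - s y₀) * n y₀) :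
    AnalyticAt ℝ (fun y => lowerOrder (s y) (e y) (m y) (n y)) y₀ := by
  have hQ := slopeSq_pos hs0 hs1 he0 hn0 hmn
  have h1 := analyticAt_slopeSq hs he hm hn
  have h2 := analyticAt_slope hs he hm hn hQ
  have h3 : AnalyticAt ℝ (fun y => slopeApprox (s y) (e y) (m y)) y₀ := by
    unfold slopeApprox
    simp only [div_eq_mul_inv]
    fun_prop
  have h4 : AnalyticAt ℝ (fun y => slopeDefect (s y) (e y) (m y) (n y)) y₀ := by
    unfold slopeDefect
    simp only [div_eq_mul_inv]
    fun_prop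
  have h5 := (slope_add_approx_pos hs0 hs1 he0 hn0 hmn).ne'
  unfold lowerOrder
  refine AnalyticAt.div (AnalyticAt.sub ?_ (AnalyticAt.div ?_ ?_ (pow_ne_zero 2 h5))) h1 hQ.ne'
  · simp only [div_eq_mul_inv]
    fun_prop
  · fun_prop
  · fun_prop

variable {x : Y → Fin 2 → ℝ} {J : Y → Jet1} {c : Chart} {R : ℝ}

theorem Chart.analyticAt_params (hR : R ∈ c.radii) (hx₀ : x y₀ ∈ c.closedDomain R)
    (hx : ∀ k, AnalyticAt ℝ (fun y => x y k) y₀) (hJ : ∀ k, AnalyticAt ℝ (fun y => (J y).2 k) y₀) :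
    AnalyticAt ℝ (fun y => c.defect (x y)) y₀ ∧
      AnalyticAt ℝ (fun y => c.radial (x y) (J y).2) y₀ ∧
      AnalyticAt ℝ (fun y => c.gradSq (x y) (J y).2) y₀ := by
  have x0 := hx 0
  have x1 := hx 1
  have d0 := hJ 0
  have d1 := hJ 1
  cases c with
  | polar =>
    have h0 : x y₀ 0 ^ 2 ≠ 0 := pow_ne_zero 2 (hR.1.trans_le hx₀.1).ne'
    refine ⟨?_, ?_, ?_⟩ <;> simp only [Chart.defect, Chart.radial, Chart.gradSq]
    · fun_prop
    · fun_prop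
    · fun_prop (disch := assumption)
  | cartesian =>
    refine ⟨?_, ?_, ?_⟩ <;> simp only [Chart.defect, Chart.radial, Chart.gradSq] <;> fun_prop

theorem Chart.analyticAt_slope (hR : R ∈ c.radii) (hx₀ : x y₀ ∈ c.closedDomain R)
    (hx : ∀ k, AnalyticAt ℝ (fun y => x y k) y₀) (hη : AnalyticAt ℝ (fun y => (J y).1) y₀)
    (hJ : ∀ k, AnalyticAt ℝ (fun y => (J y).2 k) y₀) :
    AnalyticAt ℝ (fun y => c.slope (x y) (J y)) y₀ := by
  obtain ⟨h1, h2, h3⟩ := Chart.analyticAt_params hR hx₀ hx hJ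
  exact H2R.analyticAt_slope h1 hη.rexp h2 h3 (c.slopeSq_pos hR hx₀ (J y₀))

theorem Chart.analyticAt_symbol (hR : R ∈ c.radii) (hx₀ : x y₀ ∈ c.closedDomain R)
    (hx : ∀ k, AnalyticAt ℝ (fun y => x y k) y₀) (hη : AnalyticAt ℝ (fun y => (J y).1) y₀)
    (hJ : ∀ k, AnalyticAt ℝ (fun y => (J y).2 k) y₀) (i j : Fin 2) :
    AnalyticAt ℝ (fun y => c.symbol i j (x y) (J y)) y₀ := by
  have x0 := hx 0
  have x1 := hx 1
  have d0 := hJ 0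
  have d1 := hJ 1
  have he := hη.rexp
  cases c with
  | polar =>
    have h0 : x y₀ 0 ≠ 0 := (hR.1.trans_le hx₀.1).ne'
    have h4 : (4 : ℝ) ≠ 0 := by norm_num
    fin_cases i <;> fin_cases j <;> simp [Chart.symbol] <;> fun_prop (disch := assumption)
  | cartesian =>
    have h4 : (4 : ℝ) ≠ 0 := by norm_num
    fin_cases i <;> fin_cases j <;> simp [Chart.symbol] <;> fun_prop (disch := assumption)

theorem Chart.analyticAt_principal (hR : R ∈ c.radii) (hx₀ : x y₀ ∈ c.closedDomain R)
    (hx : ∀ k, AnalyticAt ℝ (fun y => x y k) y₀) (hη : AnalyticAt ℝ (fun y => (J y).1) y₀)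
    (hJ : ∀ k, AnalyticAt ℝ (fun y => (J y).2 k) y₀) (i j : Fin 2) :
    AnalyticAt ℝ (fun y => c.principal i j (x y) (J y)) y₀ := by
  obtain ⟨h1, h2, h3⟩ := Chart.analyticAt_params hR hx₀ hx hJ
  have h4 : AnalyticAt ℝ (fun y => c.slopeSq (x y) (J y)) y₀ :=
    analyticAt_slopeSq h1 hη.rexp h2 h3
  exact ((analyticAt_const.mul hη.rexp).mul (Chart.analyticAt_symbol hR hx₀ hx hη hJ i j)).div h4
    (c.slopeSq_pos hR hx₀ (J y₀)).ne'

theorem Chart.analyticAt_lower (hR : R ∈ c.radii) (hx₀ : x y₀ ∈ c.closedDomain R)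
    (hx : ∀ k, AnalyticAt ℝ (fun y => x y k) y₀) (hη : AnalyticAt ℝ (fun y => (J y).1) y₀)
    (hJ : ∀ k, AnalyticAt ℝ (fun y => (J y).2 k) y₀) :
    AnalyticAt ℝ (fun y => c.lower (x y) (J y)) y₀ := by
  obtain ⟨h1, h2, h3⟩ := Chart.analyticAt_params hR hx₀ hx hJ
  obtain ⟨-, b0, b1, b2, b3⟩ := c.jet_bounds hR hx₀ (J y₀).2
  have h := analyticAt_lowerOrder h1 hη.rexp h2 h3 b0 b1 (Real.exp_pos _) b2 b3
  cases c with
  | polar =>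
    have x0 := hx 0
    have d0 := hJ 0
    have d1 := hJ 1
    have h0 : x y₀ 0 ≠ 0 := (hR.1.trans_le hx₀.1).ne'
    have p01 := Chart.analyticAt_principal hR hx₀ hx hη hJ 0 1
    have p11 := Chart.analyticAt_principal hR hx₀ hx hη hJ 1 1
    exact ((x0.mul h).sub (((analyticAt_const.mul p01).mul d1).div x0 h0)).add
      (p11.mul (x0.mul d0))
  | cartesian => exact h

theorem Chart.analyticAt_rescaledDefect {K : Y → Jet2} (hR : R ∈ c.radii)
    (hx₀ : x y₀ ∈ c.closedDomain R) (hx : ∀ k, AnalyticAt ℝ (fun y => x y k) y₀)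
    (hη : AnalyticAt ℝ (fun y => (K y).1) y₀)
    (hJ : ∀ k, AnalyticAt ℝ (fun y => (K y).2.1 k) y₀)
    (hK : ∀ i j, AnalyticAt ℝ (fun y => (K y).2.2 i j) y₀) :
    AnalyticAt ℝ (fun y => c.rescaledDefect (x y) (K y)) y₀ := by
  have hp := Chart.analyticAt_principal (J := fun y => ((K y).1, (K y).2.1)) hR hx₀ hx hη hJ
  have hl := Chart.analyticAt_lower (J := fun y => ((K y).1, (K y).2.1)) hR hx₀ hx hη hJ
  unfold Chart.rescaledDefect
  simp only [Fin.sum_univ_two]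
  exact ((((hp 0 0).mul (hK 0 0)).add ((hp 0 1).mul (hK 0 1))).add
    (((hp 1 0).mul (hK 1 0)).add ((hp 1 1).mul (hK 1 1)))).add hl

end Analytic

/-! ### Hölder continuity -/

open scoped Pointwise

section Holder

variable {X Y Z : Type*} [PseudoEMetricSpace X] [PseudoEMetricSpace Y] [PseudoEMetricSpace Z]
  {S : Set X} {α : NNReal}

theorem _root_.HolderOnWith.prodMk {f : X → Y} {g : X → Z} {C D : NNReal}
    (hf : HolderOnWith C α f S) (hg : HolderOnWith D α g S) :
    HolderOnWith (max C D) α (fun x => (f x, g x)) S := by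
  intro x hx y hy
  rw [Prod.edist_eq]
  exact max_le (hf.mono_const (le_max_left C D) x hx y hy)
    (hg.mono_const (le_max_right C D) x hx y hy)

theorem _root_.HolderOnWith.pi {ι : Type*} [Fintype ι] {f : X → ι → Y} {C : ι → NNReal}
    (hf : ∀ i, HolderOnWith (C i) α (fun x => f x i) S) : HolderOnWith (∑ i, C i) α f S := by
  intro x hx y hy
  rw [edist_pi_le_iff]
  intro i
  exact (hf i).mono_const (Finset.single_le_sum (fun _ _ => zero_le) (Finset.mem_univ i)) x hx y hy

theorem _root_.LipschitzOnWith.comp_holderOnWith {f : X → Y} {g : Y → Z} {C D : NNReal} {T : Set Y}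
    (hg : LipschitzOnWith C g T) (hf : HolderOnWith D α f S) (hST : Set.MapsTo f S T) :
    HolderOnWith (C * D) α (fun x => g (f x)) S := by
  have := hg.holderOnWith.comp hf hST
  rw [one_mul, NNReal.coe_one, NNReal.rpow_one] at this
  exact this

end Holder

/-- An analytic function of a Hölder continuous map on a compact set is Hölder continuous. -/
theorem exists_holderOnWith_comp {X Y : Type*} [PseudoMetricSpace X] [NormedAddCommGroup Y]
    [NormedSpace ℝ Y] {K : Set X} (hK : IsCompact K) {α C : NNReal} (hα : 0 < α) {γ : X → Y}
    (hγ : HolderOnWith C α γ K) {Φ : Y → ℝ} (hΦ : ∀ x ∈ K, AnalyticAt ℝ Φ (γ x)) :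
    ∃ D, HolderOnWith D α (fun x => Φ (γ x)) K := by
  have hc : IsCompact (γ '' K) := hK.image_of_continuousOn (hγ.continuousOn hα)
  have hl : LocallyLipschitzOn (γ '' K) Φ := by
    rintro _ ⟨x, hx, rfl⟩
    obtain ⟨L, t, ht, h⟩ := (hΦ x hx).contDiffAt.exists_lipschitzOnWith
    exact ⟨L, t, mem_nhdsWithin_of_mem_nhds ht, h⟩
  obtain ⟨L, hL⟩ := hl.exists_lipschitzOnWith_of_compact hc
  exact ⟨_, hL.comp_holderOnWith hγ (Set.mapsTo_image γ K)⟩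

/-! ### Periodicity and compactness -/

/-- A compact subset of the closed domain: in polar coordinates, three periods of the strip. -/
def Chart.core : Chart → ℝ → Set (Fin 2 → ℝ)
  | .polar, R => Set.Icc ![R, -(2 * Real.pi)] ![1, 4 * Real.pi]
  | .cartesian, R => Chart.cartesian.closedDomain R

theorem Chart.mem_core_polar {R : ℝ} {p : Fin 2 → ℝ} : p ∈ Chart.polar.core R ↔
    p ∈ Chart.polar.closedDomain R ∧ -(2 * Real.pi) ≤ p 1 ∧ p 1 ≤ 4 * Real.pi := by
  simp only [Chart.core, Chart.closedDomain, Set.mem_Icc, Pi.le_def, Fin.forall_fin_two,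
    Set.mem_ofPred_eq, Matrix.cons_val_zero, Matrix.cons_val_one, Matrix.cons_val_fin_one]
  tauto

theorem Chart.core_subset (c : Chart) (R : ℝ) : c.core R ⊆ c.closedDomain R := by
  cases c with
  | polar => exact fun p hp => (Chart.mem_core_polar.1 hp).1
  | cartesian => exact subset_rfl

theorem Chart.isCompact_core (c : Chart) (R : ℝ) : IsCompact (c.core R) := by
  cases c with
  | polar => exact isCompact_Icc
  | cartesian =>
    refine Metric.isCompact_of_isClosed_isBounded ?_ ?_
    · exact (isClosed_le (f := fun _ => R ^ 2) (by fun_prop) (by fun_prop)).inter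
        (isClosed_le (g := fun _ => (1 : ℝ)) (by fun_prop) (by fun_prop))
    · refine (Metric.isBounded_Icc (fun _ => -1) (fun _ => 1)).subset ?_
      rintro p ⟨-, h⟩
      have h0 := abs_le_of_sq_le_sq'
        (show p 0 ^ 2 ≤ 1 ^ 2 by nlinarith [sq_nonneg (p 1)]) one_pos.le
      have h1 := abs_le_of_sq_le_sq'
        (show p 1 ^ 2 ≤ 1 ^ 2 by nlinarith [sq_nonneg (p 0)]) one_pos.le
      constructor <;> intro i <;> fin_cases i
      · exact h0.1
      · exact h1.1
      · exact h0.2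
      · exact h1.2

theorem shift_zero (p : Fin 2 → ℝ) (t : ℝ) : (p + ![0, t]) 0 = p 0 := add_zero _

theorem shift_one (p : Fin 2 → ℝ) (t : ℝ) : (p + ![0, t]) 1 = p 1 + t := rfl

theorem shift_mem_polar {R : ℝ} {p : Fin 2 → ℝ} {t : ℝ} :
    p + ![0, t] ∈ Chart.polar.closedDomain R ↔ p ∈ Chart.polar.closedDomain R := by
  simp only [Chart.closedDomain, Set.mem_ofPred_eq, shift_zero]

theorem shift_add (p : Fin 2 → ℝ) (t t' : ℝ) : p + ![0, t] + ![0, t'] = p + ![0, t + t'] := by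
  ext i
  fin_cases i
  · exact add_zero _
  · exact add_assoc _ _ _

theorem Chart.IsFunction.int_mul {R : ℝ} {u : (Fin 2 → ℝ) → ℝ} (hu : Chart.polar.IsFunction R u)
    {p : Fin 2 → ℝ} (hp : p ∈ Chart.polar.closedDomain R) (n : ℤ) :
    u (p + ![0, n * (2 * Real.pi)]) = u p := by
  induction n using Int.induction_on with
  | zero =>
    congr 1
    ext i
    fin_cases i
    · exact add_zero _
    · change p 1 + _ = p 1
      simp
  | succ n ih =>
    rw [← ih, ← hu (p + ![0, ((n : ℤ) : ℝ) * (2 * Real.pi)]) (shift_mem_polar.2 hp), shift_add]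
    congr 4
    push_cast
    ring
  | pred n ih =>
    rw [← ih, ← hu (p + ![0, ((-(n : ℤ) - 1 : ℤ) : ℝ) * (2 * Real.pi)]) (shift_mem_polar.2 hp),
      shift_add]
    congr 4
    push_cast
    ring

/-- Reduction of the angle to one period. -/
theorem Chart.exists_reduction {R : ℝ} {p : Fin 2 → ℝ} (hp : p ∈ Chart.polar.closedDomain R) :
    ∃ n : ℤ, p + ![0, n * (2 * Real.pi)] ∈ Chart.polar.closedDomain R ∧
      0 ≤ (p + ![0, n * (2 * Real.pi)]) 1 ∧ (p + ![0, n * (2 * Real.pi)]) 1 ≤ 2 * Real.pi := by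
  have hpi : 0 < 2 * Real.pi := by positivity
  refine ⟨-⌊p 1 / (2 * Real.pi)⌋, ?_, ?_, ?_⟩
  · exact shift_mem_polar.2 hp
  · have := Int.floor_le (p 1 / (2 * Real.pi))
    rw [le_div_iff₀ hpi] at this
    rw [shift_one, Int.cast_neg]
    linarith
  · have := (Int.lt_floor_add_one (p 1 / (2 * Real.pi))).le
    rw [div_le_iff₀ hpi] at this
    rw [shift_one, Int.cast_neg]
    linarith

/-- A function on the closed domain takes all its values on the compact core. -/
theorem Chart.IsFunction.exists_core {c : Chart} {R : ℝ} {u : (Fin 2 → ℝ) → ℝ}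
    (hu : c.IsFunction R u) {p : Fin 2 → ℝ} (hp : p ∈ c.closedDomain R) :
    ∃ q ∈ c.core R, u q = u p := by
  cases c with
  | polar =>
    obtain ⟨n, h1, h2, h3⟩ := Chart.exists_reduction hp
    have := Real.pi_pos
    exact ⟨_, Chart.mem_core_polar.2 ⟨h1, by linarith, by linarith⟩, hu.int_mul hp n⟩
  | cartesian => exact ⟨p, hp, rfl⟩

/-- In polar coordinates, points whose angles differ by more than a period are compared after
reducing one of the angles. -/
theorem Chart.IsFunction.holderOnWith {c : Chart} {R : ℝ} {u : (Fin 2 → ℝ) → ℝ}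
    (hu : c.IsFunction R u) (hR : R ∈ c.radii) {α C : NNReal}
    (h : HolderOnWith C α u (c.core R)) : HolderOnWith C α u (c.closedDomain R) := by
  cases c with
  | cartesian => exact h
  | polar =>
    intro p hp q hq
    have hpi := Real.pi_gt_three
    obtain ⟨n, hp', hp0, hp1⟩ := Chart.exists_reduction hp
    have hup := hu.int_mul hp n
    set p' := p + ![0, n * (2 * Real.pi)] with hp'_def
    have hpc : p' ∈ Chart.polar.core R :=
      Chart.mem_core_polar.2 ⟨hp', by linarith, by linarith⟩
    by_cases hd : |p 1 - q 1| ≤ 2 * Real.pi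
    · have huq := hu.int_mul hq n
      set q' := q + ![0, n * (2 * Real.pi)] with hq'_def
      have he : edist p' q' = edist p q := edist_add_right _ _ _
      have hpq : p' 1 - q' 1 = p 1 - q 1 := by
        rw [hp'_def, hq'_def, shift_one, shift_one, add_sub_add_right_eq_sub]
      rw [← hpq, abs_le] at hd
      have hqc : q' ∈ Chart.polar.core R := by
        refine Chart.mem_core_polar.2 ⟨?_, by linarith, by linarith⟩
        exact shift_mem_polar.2 hq
      have := h p' hpc q' hqc
      rwa [hup, huq, he] at this
    · obtain ⟨k, hq', hq0, hq1⟩ := Chart.exists_reduction hq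
      have huq := hu.int_mul hq k
      set q' := q + ![0, k * (2 * Real.pi)] with hq'_def
      have hqc : q' ∈ Chart.polar.core R :=
        Chart.mem_core_polar.2 ⟨hq', by linarith, by linarith⟩
      have := h p' hpc q' hqc
      rw [hup, huq] at this
      refine this.trans ?_
      have hle : edist p' q' ≤ edist p q := by
        rw [edist_dist, edist_dist]
        refine ENNReal.ofReal_le_ofReal ?_
        have h1 : dist p' q' ≤ 2 * Real.pi := by
          refine (dist_pi_le_iff (by positivity)).2 fun i => ?_
          rw [Real.dist_eq, abs_le]
          fin_cases i
          · have a1 : R ≤ p' 0 ∧ p' 0 ≤ 1 := hp'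
            have a2 : R ≤ q' 0 ∧ q' 0 ≤ 1 := hq'
            have a3 : 0 < R := hR.1
            simp only [Fin.zero_eta]
            constructor <;> linarith [a1.1, a1.2, a2.1, a2.2]
          · simp only [Fin.mk_one]
            constructor <;> linarith
        have h2 : 2 * Real.pi ≤ dist p q :=
          (not_le.1 hd).le.trans (dist_le_pi_dist p q 1)
        exact h1.trans h2
      gcongr

/-! ### Jets of functions in Hölder spaces -/

/-- The jets of a function in the Hölder space are Hölder continuous. -/
theorem Chart.MemHolder.jet2 {c : Chart} {R : ℝ} (hR : R ∈ c.radii) {α : NNReal}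
    {u : (Fin 2 → ℝ) → ℝ} (hu : c.MemHolder R 2 α u) :
    ∃ C, HolderOnWith C α (H2R.jet2 (c.closedDomain R) u) (c.closedDomain R) := by
  have hS := c.uniqueDiffOn_closedDomain hR
  obtain ⟨-, hcd, hh⟩ := hu
  set S := c.closedDomain R with hS_def
  have key : ∀ m ≤ 2, ∀ v : Fin m → Fin 2 → ℝ,
      ∃ C, HolderOnWith C α (fun p => iteratedFDerivWithin ℝ m u S p v) S := by
    intro m hm v
    obtain ⟨C, hC⟩ := hh m hm
    have hL := (ContinuousMultilinearMap.apply ℝ (fun _ : Fin m => Fin 2 → ℝ) ℝ v).lipschitz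
    exact ⟨_, (hL.lipschitzOnWith (s := Set.univ)).comp_holderOnWith hC (Set.mapsTo_univ _ _)⟩
  obtain ⟨C0, h0⟩ := key 0 (by norm_num) 0
  have h1 : ∀ i, ∃ C, HolderOnWith C α (fun p => pd S i u p) S := by
    intro i
    obtain ⟨C, hC⟩ := key 1 (by norm_num) fun _ => Pi.single i 1
    refine ⟨C, fun p hp q hq => ?_⟩
    have := hC p hp q hq
    simp only [iteratedFDerivWithin_one_apply (hS p hp),
      iteratedFDerivWithin_one_apply (hS q hq)] at this
    exact this
  have h2 : ∀ i j, ∃ C, HolderOnWith C α (fun p => pd S i (pd S j u) p) S := by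
    intro i j
    obtain ⟨C, hC⟩ := key 2 le_rfl ![Pi.single i 1, Pi.single j 1]
    have e : ∀ p ∈ S, iteratedFDerivWithin ℝ 2 u S p ![Pi.single i 1, Pi.single j 1] =
        pd S i (pd S j u) p := by
      intro p hp
      have hd := (hcd.fderivWithin hS (m := 1) (by norm_num)).differentiableOn (by norm_num) p hp
      rw [iteratedFDerivWithin_two_apply u hS hp]
      unfold pd
      rw [fderivWithin_clm_apply (hS p hp) hd (differentiableWithinAt_const _)]
      simp
    refine ⟨C, fun p hp q hq => ?_⟩
    have := hC p hp q hq
    simp only [e p hp, e q hq] at this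
    exact this
  choose C1 hC1 using h1
  choose C2 hC2 using h2
  have h0' : HolderOnWith C0 α u S := by simpa using h0
  exact ⟨_, h0'.prodMk (HolderOnWith.prodMk (HolderOnWith.pi hC1)
    (HolderOnWith.pi fun i => HolderOnWith.pi fun j => hC2 i j))⟩

theorem Chart.MemHolder.jet1 {c : Chart} {R : ℝ} (hR : R ∈ c.radii) {α : NNReal}
    {u : (Fin 2 → ℝ) → ℝ} (hu : c.MemHolder R 2 α u) :
    ∃ C, HolderOnWith C α (H2R.jet1 (c.closedDomain R) u) (c.closedDomain R) := by
  obtain ⟨C, hC⟩ := hu.jet2 hR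
  refine ⟨C, fun p hp q hq => le_trans ?_ (hC p hp q hq)⟩
  rw [Prod.edist_eq, Prod.edist_eq, Prod.edist_eq]
  exact max_le_max le_rfl (le_max_left _ _)

/-- The part of `MemHolder` for `k = 0` that remains once periodicity is known. -/
theorem Chart.IsFunction.memHolder_zero {c : Chart} {R : ℝ} {u : (Fin 2 → ℝ) → ℝ}
    (hu : c.IsFunction R u) (hR : R ∈ c.radii) {α C : NNReal} (hα : 0 < α)
    (h : HolderOnWith C α u (c.core R)) : c.MemHolder R 0 α u := by
  have h' := hu.holderOnWith hR h
  refine ⟨hu, ?_, ?_⟩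
  · simpa using h'.continuousOn hα
  · intro m hm
    obtain rfl : m = 0 := Nat.le_zero.1 hm
    rw [iteratedFDerivWithin_zero_eq_comp]
    exact ⟨_, ((LinearIsometryEquiv.lipschitz _).lipschitzOnWith (s := Set.univ)).comp_holderOnWith
      h' (Set.mapsTo_univ _ _)⟩

theorem pd_periodic {R : ℝ} {u : (Fin 2 → ℝ) → ℝ} (hu : Chart.polar.IsFunction R u) (i : Fin 2) :
    Chart.polar.IsFunction R (pd (Chart.polar.closedDomain R) i u) := by
  intro p hp
  have hv : (![0, 2 * Real.pi] : Fin 2 → ℝ) +ᵥ Chart.polar.closedDomain R =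
      Chart.polar.closedDomain R := by
    ext q
    rw [Set.mem_vadd_set_iff_neg_vadd_mem, vadd_eq_add, add_comm]
    have : q + -![0, 2 * Real.pi] = q + ![0, -(2 * Real.pi)] := by simp
    rw [this, shift_mem_polar]
  unfold pd
  have := fderivWithin_comp_add_right (𝕜 := ℝ) (f := u) (x := p) (s := Chart.polar.closedDomain R)
    ![0, 2 * Real.pi]
  rw [hv] at this
  rw [← this, fderivWithin_congr (fun q hq => hu q hq) (hu p hp)]

theorem jet2_periodic {R : ℝ} {u : (Fin 2 → ℝ) → ℝ} (hu : Chart.polar.IsFunction R u)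
    {p : Fin 2 → ℝ} (hp : p ∈ Chart.polar.closedDomain R) :
    jet2 (Chart.polar.closedDomain R) u (p + ![0, 2 * Real.pi]) =
      jet2 (Chart.polar.closedDomain R) u p := by
  simp only [jet2, hu p hp, pd_periodic hu _ p hp, pd_periodic (pd_periodic hu _) _ p hp]

theorem jet1_periodic {R : ℝ} {u : (Fin 2 → ℝ) → ℝ} (hu : Chart.polar.IsFunction R u)
    {p : Fin 2 → ℝ} (hp : p ∈ Chart.polar.closedDomain R) :
    jet1 (Chart.polar.closedDomain R) u (p + ![0, 2 * Real.pi]) =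
      jet1 (Chart.polar.closedDomain R) u p := by
  simp only [jet1, hu p hp, pd_periodic hu _ p hp]

/-! ### The quasilinear operator -/

/-- The coefficients of the second derivatives of `ξ` at `(x, (a, Da), (ξ, Dξ))`: the principal part
at `a + ξ`, times the ratio of the area elements of `a` and `a + ξ`. -/
def Chart.coeffA (c : Chart) (i j : Fin 2) (y : (Fin 2 → ℝ) × Jet1 × Jet1) : ℝ :=
  1 / 2 * (c.slope y.1 y.2.1 / c.slope y.1 (y.2.1 + y.2.2)) * c.principal i j y.1 (y.2.1 + y.2.2)

/-- The terms without second derivatives of `ξ` at `(x, (a, Da, D²a), (ξ, Dξ))`. -/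
def Chart.coeffB (c : Chart) (y : (Fin 2 → ℝ) × Jet2 × Jet1) : ℝ :=
  1 / 2 * (c.slope y.1 (y.2.1.1, y.2.1.2.1) /
      c.slope y.1 (y.2.1.1 + y.2.2.1, y.2.1.2.1 + y.2.2.2) *
      c.rescaledDefect y.1 (y.2.1.1 + y.2.2.1, y.2.1.2.1 + y.2.2.2, y.2.1.2.2) -
    c.rescaledDefect y.1 y.2.1)

theorem Chart.coeffA_comm (c : Chart) (i j : Fin 2) (y : (Fin 2 → ℝ) × Jet1 × Jet1) :
    c.coeffA i j y = c.coeffA j i y := by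
  simp only [Chart.coeffA, Chart.principal, c.symbol_comm i j]

section

variable {Y E F : Type*} [NormedAddCommGroup Y] [NormedSpace ℝ Y] [NormedAddCommGroup E]
  [NormedSpace ℝ E] [NormedAddCommGroup F] [NormedSpace ℝ F] {y₀ : Y}

theorem _root_.AnalyticAt.apply_pi {f : Y → Fin 2 → E} (hf : AnalyticAt ℝ f y₀) (k : Fin 2) :
    AnalyticAt ℝ (fun y => f y k) y₀ :=
  AnalyticAt.comp (g := fun v : Fin 2 → E => v k)
    ((ContinuousLinearMap.proj (R := ℝ) (φ := fun _ : Fin 2 => E) k).analyticAt _) hf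

theorem _root_.AnalyticAt.prod_fst {f : Y → E × F} (hf : AnalyticAt ℝ f y₀) :
    AnalyticAt ℝ (fun y => (f y).1) y₀ :=
  AnalyticAt.comp (g := Prod.fst) analyticAt_fst hf

theorem _root_.AnalyticAt.prod_snd {f : Y → E × F} (hf : AnalyticAt ℝ f y₀) :
    AnalyticAt ℝ (fun y => (f y).2) y₀ :=
  AnalyticAt.comp (g := Prod.snd) analyticAt_snd hf

end

theorem Chart.analyticAt_coeffA (c : Chart) {R : ℝ} (hR : R ∈ c.radii) (i j : Fin 2)
    {y₀ : (Fin 2 → ℝ) × Jet1 × Jet1} (hy : y₀.1 ∈ c.closedDomain R) :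
    AnalyticAt ℝ (c.coeffA i j) y₀ := by
  have hx : ∀ k, AnalyticAt ℝ (fun y : (Fin 2 → ℝ) × Jet1 × Jet1 => y.1 k) y₀ :=
    fun k => analyticAt_fst.apply_pi k
  have ha : AnalyticAt ℝ (fun y : (Fin 2 → ℝ) × Jet1 × Jet1 => y.2.1) y₀ :=
    analyticAt_snd.prod_fst
  have hξ : AnalyticAt ℝ (fun y : (Fin 2 → ℝ) × Jet1 × Jet1 => y.2.2) y₀ :=
    analyticAt_snd.prod_snd
  have hb := ha.add hξ
  have h1 := Chart.analyticAt_slope (x := fun y : (Fin 2 → ℝ) × Jet1 × Jet1 => y.1) hR hy hx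
    (J := fun y => y.2.1) ha.prod_fst ha.prod_snd.apply_pi
  have h2 := Chart.analyticAt_slope (x := fun y : (Fin 2 → ℝ) × Jet1 × Jet1 => y.1) hR hy hx
    (J := fun y => y.2.1 + y.2.2) hb.prod_fst hb.prod_snd.apply_pi
  have h3 := Chart.analyticAt_principal (x := fun y : (Fin 2 → ℝ) × Jet1 × Jet1 => y.1) hR hy hx
    (J := fun y => y.2.1 + y.2.2) hb.prod_fst hb.prod_snd.apply_pi i j
  exact (analyticAt_const.mul (h1.div h2 (c.slope_pos hR hy _).ne')).mul h3

theorem Chart.analyticAt_coeffB (c : Chart) {R : ℝ} (hR : R ∈ c.radii)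
    {y₀ : (Fin 2 → ℝ) × Jet2 × Jet1} (hy : y₀.1 ∈ c.closedDomain R) :
    AnalyticAt ℝ c.coeffB y₀ := by
  have hx : ∀ k, AnalyticAt ℝ (fun y : (Fin 2 → ℝ) × Jet2 × Jet1 => y.1 k) y₀ :=
    fun k => analyticAt_fst.apply_pi k
  have ha : AnalyticAt ℝ (fun y : (Fin 2 → ℝ) × Jet2 × Jet1 => y.2.1) y₀ :=
    analyticAt_snd.prod_fst
  have hξ : AnalyticAt ℝ (fun y : (Fin 2 → ℝ) × Jet2 × Jet1 => y.2.2) y₀ :=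
    analyticAt_snd.prod_snd
  have b0 := ha.prod_fst.add hξ.prod_fst
  have b1 := ha.prod_snd.prod_fst.add hξ.prod_snd
  have a2 : ∀ i j, AnalyticAt ℝ (fun y : (Fin 2 → ℝ) × Jet2 × Jet1 => y.2.1.2.2 i j) y₀ := by
    intro i j
    exact (ha.prod_snd.prod_snd.apply_pi i).apply_pi j
  have h1 := Chart.analyticAt_slope (x := fun y : (Fin 2 → ℝ) × Jet2 × Jet1 => y.1) hR hy hx
    (J := fun y => (y.2.1.1, y.2.1.2.1)) ha.prod_fst ha.prod_snd.prod_fst.apply_pi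
  have h2 := Chart.analyticAt_slope (x := fun y : (Fin 2 → ℝ) × Jet2 × Jet1 => y.1) hR hy hx
    (J := fun y => (y.2.1.1 + y.2.2.1, y.2.1.2.1 + y.2.2.2)) b0 b1.apply_pi
  have h3 := Chart.analyticAt_rescaledDefect (x := fun y : (Fin 2 → ℝ) × Jet2 × Jet1 => y.1) hR hy
    hx (K := fun y => (y.2.1.1 + y.2.2.1, y.2.1.2.1 + y.2.2.2, y.2.1.2.2)) b0 b1.apply_pi a2
  have h4 := Chart.analyticAt_rescaledDefect (x := fun y : (Fin 2 → ℝ) × Jet2 × Jet1 => y.1) hR hy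
    hx (K := fun y => y.2.1) ha.prod_fst ha.prod_snd.prod_fst.apply_pi a2
  exact analyticAt_const.mul (((h1.div h2 (c.slope_pos hR hy _).ne').mul h3).sub h4)

/-- In polar coordinates nothing depends on the angle. -/
theorem polar_slope_congr {x x' : Fin 2 → ℝ} (h : x 0 = x' 0) (J : Jet1) :
    Chart.polar.slope x J = Chart.polar.slope x' J := by
  simp only [Chart.slope, Chart.defect, Chart.radial, Chart.gradSq, h]

theorem polar_principal_congr {x x' : Fin 2 → ℝ} (h : x 0 = x' 0) (i j : Fin 2) (J : Jet1) :
    Chart.polar.principal i j x J = Chart.polar.principal i j x' J := by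
  simp only [Chart.principal, Chart.symbol, Chart.slopeSq, Chart.defect, Chart.radial,
    Chart.gradSq, h]

theorem polar_rescaledDefect_congr {x x' : Fin 2 → ℝ} (h : x 0 = x' 0) (J : Jet2) :
    Chart.polar.rescaledDefect x J = Chart.polar.rescaledDefect x' J := by
  simp only [Chart.rescaledDefect, Chart.lower, polar_principal_congr h, Chart.defect,
    Chart.radial, Chart.gradSq, h]

theorem Chart.isFunction_coeffA {c : Chart} {R : ℝ} {a ξ : (Fin 2 → ℝ) → ℝ}
    (ha : c.IsFunction R a) (hξ : c.IsFunction R ξ) (i j : Fin 2) :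
    c.IsFunction R fun p =>
      c.coeffA i j (p, jet1 (c.closedDomain R) a p, jet1 (c.closedDomain R) ξ p) := by
  cases c with
  | polar =>
    intro p hp
    have h := shift_zero p (2 * Real.pi)
    simp only [Chart.coeffA, jet1_periodic ha hp, jet1_periodic hξ hp, polar_slope_congr h,
      polar_principal_congr h]
  | cartesian => trivial

theorem Chart.isFunction_coeffB {c : Chart} {R : ℝ} {a ξ : (Fin 2 → ℝ) → ℝ}
    (ha : c.IsFunction R a) (hξ : c.IsFunction R ξ) :
    c.IsFunction R fun p =>
      c.coeffB (p, jet2 (c.closedDomain R) a p, jet1 (c.closedDomain R) ξ p) := by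
  cases c with
  | polar =>
    intro p hp
    have h := shift_zero p (2 * Real.pi)
    simp only [Chart.coeffB, jet2_periodic ha hp, jet1_periodic hξ hp, polar_slope_congr h,
      polar_rescaledDefect_congr h]
  | cartesian => trivial

theorem jet2_add {S : Set (Fin 2 → ℝ)} {p : Fin 2 → ℝ} (hS : UniqueDiffOn ℝ S) (hp : p ∈ S)
    {a ξ : (Fin 2 → ℝ) → ℝ} (ha : ContDiffOn ℝ 2 a S) (hξ : ContDiffOn ℝ 2 ξ S) :
    jet2 S (fun q => a q + ξ q) p = (a p + ξ p, (jet1 S a p).2 + (jet1 S ξ p).2,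
      fun i j => pd S i (pd S j a) p + pd S i (pd S j ξ) p) := by
  have h1 : ∀ i, ∀ q ∈ S, pd S i (fun q => a q + ξ q) q = pd S i a q + pd S i ξ q := fun i q hq =>
    pd_add (hS q hq) (ha.differentiableOn (by norm_num) q hq)
      (hξ.differentiableOn (by norm_num) q hq)
  have h2 : ∀ i j, pd S i (pd S j (fun q => a q + ξ q)) p =
      pd S i (pd S j a) p + pd S i (pd S j ξ) p := by
    intro i j
    rw [pd_congr (v := fun q => pd S j a q + pd S j ξ q)
      (eventually_nhdsWithin_of_forall (h1 j)) hp,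
      pd_add (hS p hp) (differentiableWithinAt_pd hS ha hp j)
        (differentiableWithinAt_pd hS hξ hp j)]
  simp only [jet2, h2, h1 _ p hp]
  rfl

/-- The difference of the mean curvatures, after the constant `1/2` is subtracted from both. The
defect of `a + ξ` is rescaled by the area element of `a + ξ` instead of that of `a`; the ratio of
the two is that of the slopes, which is regular at `|z| = 1`. -/
theorem Chart.sqrt_detMetric_mul_sub (c : Chart) {R : ℝ} (hR : R ∈ c.radii)
    {a ξ : (Fin 2 → ℝ) → ℝ} (ha : ContDiffOn ℝ 2 a (c.closedDomain R))
    (hξ : ContDiffOn ℝ 2 ξ (c.closedDomain R)) {p : Fin 2 → ℝ} (hp : p ∈ c.domain R) :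
    √(c.detMetric R a p) * (c.H R (fun q => a q + ξ q) p - c.H R a p) =
      ∑ i, ∑ j, c.coeffA i j (p, jet1 (c.closedDomain R) a p, jet1 (c.closedDomain R) ξ p) *
        pd (c.closedDomain R) i (pd (c.closedDomain R) j ξ) p +
      c.coeffB (p, jet2 (c.closedDomain R) a p, jet1 (c.closedDomain R) ξ p) := by
  have hS := c.uniqueDiffOn_closedDomain hR
  have hpS : p ∈ c.closedDomain R := by
    cases c with
    | polar => exact ⟨hp.1, hp.2.le⟩
    | cartesian => exact ⟨hp.1, hp.2.le⟩
  have hs : 0 < c.defect p := by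
    cases c with
    | polar =>
      change 0 < 1 - p 0 ^ 2
      have h1 := hp.1
      have h2 := hp.2
      have h3 := hR.1
      nlinarith
    | cartesian => exact sub_pos.2 hp.2
  obtain ⟨hdet, hHa⟩ := c.operator hR hp ha
  obtain ⟨-, hHb⟩ := c.operator hR hp (ha.add hξ)
  set S := c.closedDomain R with hS_def
  obtain ⟨hj, -, hs1, -⟩ := c.jet_bounds hR hpS 0
  have hj1 : jet1 S (fun q => a q + ξ q) p = jet1 S a p + jet1 S ξ p := by
    have := jet2_add hS hpS ha hξ
    exact Prod.ext rfl (congrArg (fun J : Jet2 => J.2.1) this)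
  have hVa := c.slope_pos hR hpS (jet1 S a p)
  have hVb := c.slope_pos hR hpS (jet1 S a p + jet1 S ξ p)
  change c.jacobian p * (16 * (2 - c.defect p) * c.slope p (jet1 S (fun q => a q + ξ q) p) /
    c.defect p ^ 4) * _ = _ at hHb
  rw [hj1, jet2_add hS hpS ha hξ] at hHb
  have h2s : 0 < 2 - c.defect p := by linarith
  rw [hdet, Real.sqrt_sq (by positivity)]
  have hB : c.coeffB (p, jet2 S a p, jet1 S ξ p) = 1 / 2 * (c.slope p (jet1 S a p) /
      c.slope p (jet1 S a p + jet1 S ξ p) * c.rescaledDefect p (a p + ξ p,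
        (jet1 S a p).2 + (jet1 S ξ p).2, fun i j => pd S i (pd S j a) p) -
      c.rescaledDefect p (jet2 S a p)) := rfl
  have hA : ∀ i j, c.coeffA i j (p, jet1 S a p, jet1 S ξ p) = 1 / 2 * (c.slope p (jet1 S a p) /
      c.slope p (jet1 S a p + jet1 S ξ p)) * c.principal i j p (a p + ξ p,
        (jet1 S a p).2 + (jet1 S ξ p).2) := fun _ _ => rfl
  have hsplit : c.rescaledDefect p (a p + ξ p, (jet1 S a p).2 + (jet1 S ξ p).2,
      fun i j => pd S i (pd S j a) p + pd S i (pd S j ξ) p) =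
      ∑ i, ∑ j, c.principal i j p (a p + ξ p, (jet1 S a p).2 + (jet1 S ξ p).2) *
        pd S i (pd S j ξ) p +
      c.rescaledDefect p (a p + ξ p, (jet1 S a p).2 + (jet1 S ξ p).2,
        fun i j => pd S i (pd S j a) p) := by
    simp only [Chart.rescaledDefect, Fin.sum_univ_two]
    ring
  rw [hsplit] at hHb
  rw [hB, ← hHa]
  simp only [hA, mul_assoc (1 / 2 * (c.slope p (jet1 S a p) /
    c.slope p (jet1 S a p + jet1 S ξ p))), ← Finset.mul_sum]
  rw [eq_sub_of_add_eq hHb.symm]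
  field_simp
  ring

/-- The coefficient matrix is positive definite, and its lowest eigenvalue is bounded below, because
it is a continuous function on a compact set. -/
theorem Chart.exists_coercive (c : Chart) {R : ℝ} (hR : R ∈ c.radii)
    {M : Fin 2 → Fin 2 → (Fin 2 → ℝ) → ℝ} (hM : ∀ i j, ContinuousOn (M i j) (c.closedDomain R))
    (hf : ∀ i j, c.IsFunction R (M i j)) (hsymm : ∀ p, M 1 0 p = M 0 1 p)
    (hdet : ∀ p ∈ c.closedDomain R, 0 < M 0 0 p * M 1 1 p - M 0 1 p ^ 2)
    (htr : ∀ p ∈ c.closedDomain R, 0 < M 0 0 p + M 1 1 p) :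
    ∃ κ : ℝ, 0 < κ ∧ ∀ p ∈ c.closedDomain R, ∀ v : Fin 2 → ℝ,
      κ * ∑ i, v i ^ 2 ≤ ∑ i, ∑ j, M i j p * v i * v j := by
  set q : (Fin 2 → ℝ) → ℝ := fun p => (M 0 0 p * M 1 1 p - M 0 1 p ^ 2) / (M 0 0 p + M 1 1 p)
  have hq : ContinuousOn q (c.closedDomain R) :=
    (((hM 0 0).mul (hM 1 1)).sub ((hM 0 1).pow 2)).div ((hM 0 0).add (hM 1 1))
      fun p hp => (htr p hp).ne'
  have hqf : c.IsFunction R q := by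
    cases c with
    | polar =>
      intro p hp
      simp only [q, hf _ _ p hp]
    | cartesian => trivial
  have hq0 : ∀ p ∈ c.core R, 0 < q p := fun p hp =>
    div_pos (hdet p (c.core_subset R hp)) (htr p (c.core_subset R hp))
  obtain ⟨κ, hκ, hle⟩ := (c.isCompact_core R).exists_forall_le' (hq.mono (c.core_subset R)) hq0
  refine ⟨κ, hκ, fun p hp v => ?_⟩
  obtain ⟨p', hp', he⟩ := hqf.exists_core hp
  have h1 : κ ≤ q p := he ▸ hle p' hp'
  have h2 := det_div_trace_mul_le (b := M 0 1 p) (x := v 0) (y := v 1) (htr p hp)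
  simp only [Fin.sum_univ_two, hsymm]
  exact (mul_le_mul_of_nonneg_right h1 (by positivity)).trans h2

end H2R

end

theorem mainTheorem7 (c : H2R.Chart) :
    ∃ (A : Fin 2 → Fin 2 → (Fin 2 → ℝ) × H2R.Jet1 × H2R.Jet1 → ℝ)
      (B : (Fin 2 → ℝ) × H2R.Jet2 × H2R.Jet1 → ℝ),
      (∀ i j x, A i j x = A j i x) ∧
      ∀ R ∈ c.radii,
        (∀ i j, AnalyticOnNhd ℝ (A i j) {x | x.1 ∈ c.closedDomain R}) ∧
        AnalyticOnNhd ℝ B {x | x.1 ∈ c.closedDomain R} ∧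
        ∀ α : NNReal, 0 < α → α < 1 → ∀ a ξ : (Fin 2 → ℝ) → ℝ,
          c.MemHolder R 2 α a → c.MemHolder R 2 α ξ →
          (∀ p ∈ c.domain R,
            Real.sqrt (c.detMetric R a p) * (c.H R (fun q => a q + ξ q) p - c.H R a p) =
              ∑ i, ∑ j,
                A i j (p, H2R.jet1 (c.closedDomain R) a p, H2R.jet1 (c.closedDomain R) ξ p) *
                  H2R.pd (c.closedDomain R) i (H2R.pd (c.closedDomain R) j ξ) p +
              B (p, H2R.jet2 (c.closedDomain R) a p, H2R.jet1 (c.closedDomain R) ξ p)) ∧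
          (∀ i j, c.MemHolder R 0 α (fun p =>
            A i j (p, H2R.jet1 (c.closedDomain R) a p, H2R.jet1 (c.closedDomain R) ξ p))) ∧
          c.MemHolder R 0 α (fun p =>
            B (p, H2R.jet2 (c.closedDomain R) a p, H2R.jet1 (c.closedDomain R) ξ p)) ∧
          ∃ κ : ℝ, 0 < κ ∧ ∀ p ∈ c.closedDomain R, ∀ v : Fin 2 → ℝ,
            κ * ∑ i, v i ^ 2 ≤
              ∑ i, ∑ j,
                A i j (p, H2R.jet1 (c.closedDomain R) a p, H2R.jet1 (c.closedDomain R) ξ p) *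
                  v i * v j := by
  refine ⟨c.coeffA, c.coeffB, c.coeffA_comm, fun R hR => ⟨fun i j y hy =>
    c.analyticAt_coeffA hR i j hy, fun y hy => c.analyticAt_coeffB hR hy, ?_⟩⟩
  intro α hα hα1 a ξ ha hξ
  set S := c.closedDomain R with hS
  obtain ⟨Ca, hCa⟩ := ha.jet2 hR
  obtain ⟨Ca', hCa'⟩ := ha.jet1 hR
  obtain ⟨Cξ, hCξ⟩ := hξ.jet1 hR
  have hK := c.isCompact_core R
  have hsub := c.core_subset R
  -- on the bounded core, the identity is Hölder continuous with any exponent below one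
  obtain ⟨D, hD⟩ : ∃ D : NNReal, ∀ x ∈ c.core R, ∀ y ∈ c.core R, edist x y ≤ D := by
    obtain ⟨D, hD⟩ := Metric.isBounded_iff_nndist.1 hK.isBounded
    exact ⟨D, fun x hx y hy => by
      rw [edist_nndist]
      exact ENNReal.coe_le_coe.2 (hD hx hy)⟩
  have hid := (LipschitzWith.id.lipschitzOnWith (s := c.core R)).holderOnWith.of_le hD hα1.le
  have hA : ∀ i j, c.MemHolder R 0 α
      (fun p => c.coeffA i j (p, H2R.jet1 S a p, H2R.jet1 S ξ p)) := by
    intro i j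
    obtain ⟨C, hC⟩ := H2R.exists_holderOnWith_comp hK hα
      (hid.prodMk ((hCa'.mono hsub).prodMk (hCξ.mono hsub))) (Φ := c.coeffA i j)
      fun p hp => c.analyticAt_coeffA hR i j (hsub hp)
    exact (H2R.Chart.isFunction_coeffA ha.1 hξ.1 i j).memHolder_zero hR hα hC
  refine ⟨fun p hp => c.sqrt_detMetric_mul_sub hR ha.2.1 hξ.2.1 hp, hA, ?_, ?_⟩
  · obtain ⟨C, hC⟩ := H2R.exists_holderOnWith_comp hK hα
      (hid.prodMk ((hCa.mono hsub).prodMk (hCξ.mono hsub))) (Φ := c.coeffB)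
      fun p hp => c.analyticAt_coeffB hR (hsub hp)
    exact (H2R.Chart.isFunction_coeffB ha.1 hξ.1).memHolder_zero hR hα hC
  · have hpos : ∀ p ∈ S, 0 < 1 / 2 * (c.slope p (H2R.jet1 S a p) /
        c.slope p (H2R.jet1 S a p + H2R.jet1 S ξ p)) := fun p hp =>
      mul_pos (by norm_num) (div_pos (c.slope_pos hR hp _) (c.slope_pos hR hp _))
    refine c.exists_coercive hR
      (M := fun i j p => c.coeffA i j (p, H2R.jet1 S a p, H2R.jet1 S ξ p))
      (fun i j => (hA i j).2.1.continuousOn)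
      (fun i j => (hA i j).1) (fun p => c.coeffA_comm _ _ _) ?_ ?_
    · intro p hp
      have := mul_pos (pow_pos (hpos p hp) 2)
        (c.principal_pos hR hp (H2R.jet1 S a p + H2R.jet1 S ξ p)).1
      simp only [H2R.Chart.coeffA]
      linarith
    · intro p hp
      have := mul_pos (hpos p hp) (c.principal_pos hR hp (H2R.jet1 S a p + H2R.jet1 S ξ p)).2
      simp only [H2R.Chart.coeffA]
      linarith
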